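/- Let $\mathbb T\subset\mathbb C$ be the unit circle with normalised arc length, let $H^2\subset L^2(\mathbb T)$ be the Hardy space, i.e. the closed linear span of the functions $\chi_n(z)=z^n$, $n\ge 0$, and let $P:L^2(\mathbb T)\to H^2$ be the orthogonal projection. For $\varphi\in C(\mathbb T)$ let $T_\varphi f=P(\varphi f)$ be the Toeplitz operator on $H^2$, let $\mathfrak T\subset\mathcal B(H^2)$ be the Toeplitz algebra, i.e. the $C^*$-algebra generated by all $T_\varphi$ with $\varphi\in C(\mathbb T)$, and let $\mathfrak k$ be the ideal of compact operators on $H^2$. Let $G=\mathfrak T^\times$ be the (real) Banach--Lie group of invertible elements of $\mathfrak T$, let $K=(\mathbb 1+\mathfrak k)^\times=\{g\in\mathfrak T^\times : g-\mathbb 1\in\mathfrak k\}$, a normal subgroup of $G$, and let $\pi:G\to G/K$ be the quotient map. For $\varphi\in C(\mathbb T)^\times$, the winding number of $\varphi$ is $(\psi(2\pi)-\psi(0))/(2\pi i)\in\mathbb Z$, where $\psi:\mathbb R\to\mathbb C$ is any continuous function with $e^{\psi(t)}=\varphi(e^{it})$ for all $t$. With the quotient topology, $G/K$ carries a structure of Hausdorff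 smooth real Banach manifold modelled on $C(\mathbb T)$ for which $G/K$ is a Banach--Lie group and $\pi$ is a submersion (a smooth map whose differential at every point is surjective). With any such structure, $G/K$ is isomorphic, as a Banach--Lie group (by a group isomorphism that is smooth in both directions), to the open subgroup of $C(\mathbb T)^\times$ consisting of the elements with winding number $0$. In particular, the group $G/K$ is abelian. -/

import Mathlib

open MeasureTheory
open scoped Manifold ContDiff ENNReal

noncomputable section

/-! ### The Hardy space, Toeplitz operators and the Toeplitz algebra -/

instance Circle.borelMeasurableSpace : MeasurableSpace Circle := borel Circle

instance Circle.borelSpaceInst : BorelSpace Circle := ⟨rfl⟩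

/-- The normalised arc length on the unit circle, i.e. its Haar probability measure. -/
def circleMeasure : Measure Circle := Measure.haarMeasure ⊤

instance : IsProbabilityMeasure circleMeasure := ⟨Measure.haarMeasure_self⟩

/-- The complex Hilbert space `L²(𝕋)`. -/
abbrev L2Circle : Type := Lp ℂ 2 circleMeasure

/-- The monomial `χₙ(z) = zⁿ` as a continuous function on the unit circle. -/
def monomial (n : ℤ) : C(Circle, ℂ) := 
  ⟨fun z => ((z ^ n : Circle) : ℂ), continuous_subtype_val.comp (continuous_zpow n)⟩

/-- The Hardy space as a subspace: the closed span in `L²(𝕋)` of the `χₙ` with `n ≥ 0`. -/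
def hardySubspace : Submodule ℂ L2Circle :=
  (Submodule.span ℂ (Set.range fun n : ℕ =>
    ContinuousMap.toLp 2 circleMeasure ℂ (monomial n))).topologicalClosure

instance : CompleteSpace hardySubspace :=
  (Submodule.isClosed_topologicalClosure _).completeSpace_coe

/-- The Hardy space `H²` as a Hilbert space in its own right. -/
def HardySpace : Type := hardySubspace

instance : NormedAddCommGroup HardySpace := inferInstanceAs (NormedAddCommGroup hardySubspace)

instance : InnerProductSpace ℂ HardySpace := inferInstanceAs (InnerProductSpace ℂ hardySubspace)

instance : CompleteSpace HardySpace := inferInstanceAs (CompleteSpace hardySubspace)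

/-- The isometric inclusion `H² → L²(𝕋)`. -/
def hardyInclusion : HardySpace →ₗᵢ[ℂ] L2Circle := hardySubspace.subtypeₗᵢ

/-- The orthogonal projection `P : L²(𝕋) → H²`. -/
def hardyProjection : L2Circle →L[ℂ] HardySpace := hardySubspace.orthogonalProjectionOnto

/-- The operator `f ↦ φ f` on `L²(𝕋)`. -/
def mulOperator (φ : C(Circle, ℂ)) : L2Circle →L[ℂ] L2Circle :=
  (ContinuousLinearMap.mul ℂ ℂ).holderL circleMeasure ∞ 2 2
    (ContinuousMap.toLp ∞ circleMeasure ℂ φ)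

/-- `mulOperator φ` is pointwise multiplication by `φ`. -/
theorem mulOperator_coeFn (φ : C(Circle, ℂ)) (f : L2Circle) :
    mulOperator φ f =ᵐ[circleMeasure] fun z => φ z * f z := by
  have h := (ContinuousLinearMap.mul ℂ ℂ).coeFn_holder (r := 2)
    (ContinuousMap.toLp ∞ circleMeasure ℂ φ) f
  refine Filter.EventuallyEq.trans h ?_
  filter_upwards [ContinuousMap.coeFn_toLp (p := ∞) (𝕜 := ℂ) circleMeasure φ] with z hz
  rw [hz, ContinuousLinearMap.mul_apply']

/-- The Toeplitz operator `T_φ f = P(φ f)` on `H²`. -/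
def toeplitz (φ : C(Circle, ℂ)) : HardySpace →L[ℂ] HardySpace :=
  hardyProjection ∘L mulOperator φ ∘L hardyInclusion.toContinuousLinearMap

/-- The Toeplitz algebra: the `C⋆`-algebra of operators on `H²` generated by all `T_φ`
with `φ ∈ C(𝕋)`. -/
def toeplitzAlgebra : StarSubalgebra ℂ (HardySpace →L[ℂ] HardySpace) :=
  (StarAlgebra.adjoin ℂ (Set.range toeplitz)).topologicalClosure

instance : IsClosed (toeplitzAlgebra : Set (HardySpace →L[ℂ] HardySpace)) :=
  StarSubalgebra.isClosed_topologicalClosure _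

instance : CompleteSpace toeplitzAlgebra :=
  (StarSubalgebra.isClosed_topologicalClosure _).completeSpace_coe

/-- The ideal `𝔨` of the compact operators on `H²` (lying in the Toeplitz algebra). -/
def compactIdeal : Ideal toeplitzAlgebra where
  carrier := {a | IsCompactOperator (a : HardySpace →L[ℂ] HardySpace)}
  zero_mem' := isCompactOperator_zero
  add_mem' := fun ha hb => IsCompactOperator.add ha hb
  smul_mem' := fun c _ ha =>
    IsCompactOperator.clm_comp ha (c : HardySpace →L[ℂ] HardySpace)

theorem compactIdeal_mul_mem_right {a : toeplitzAlgebra} (ha : a ∈ compactIdeal)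
    (b : toeplitzAlgebra) : a * b ∈ compactIdeal :=
  IsCompactOperator.comp_clm ha (b : HardySpace →L[ℂ] HardySpace)

/-- The subgroup `(1 + 𝔨)ˣ` of the group of invertible elements of the Toeplitz algebra. -/
def onePlusCompact : Subgroup toeplitzAlgebraˣ where
  carrier := {g | (g : toeplitzAlgebra) - 1 ∈ compactIdeal}
  one_mem' := by simp
  mul_mem' := by
    intro a b ha hb
    have h : ((a * b : toeplitzAlgebraˣ) : toeplitzAlgebra) - 1
        = (a : toeplitzAlgebra) * ((b : toeplitzAlgebra) - 1) + ((a : toeplitzAlgebra) - 1) := by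
      rw [Units.val_mul, mul_sub, mul_one]; abel
    simp only [Set.mem_ofPred_eq] at ha hb ⊢
    rw [h]
    exact add_mem (Ideal.mul_mem_left _ _ hb) ha
  inv_mem' := by
    intro a ha
    have h : ((a⁻¹ : toeplitzAlgebraˣ) : toeplitzAlgebra) - 1
        = -(((a⁻¹ : toeplitzAlgebraˣ) : toeplitzAlgebra) * ((a : toeplitzAlgebra) - 1)) := by
      rw [mul_sub, Units.inv_mul]; simp
    simp only [Set.mem_ofPred_eq] at ha ⊢
    rw [h]
    exact neg_mem (Ideal.mul_mem_left _ _ ha)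

instance : onePlusCompact.Normal where
  conj_mem := by
    intro n hn g
    have h : ((g * n * g⁻¹ : toeplitzAlgebraˣ) : toeplitzAlgebra) - 1
        = (g : toeplitzAlgebra) * ((n : toeplitzAlgebra) - 1)
          * ((g⁻¹ : toeplitzAlgebraˣ) : toeplitzAlgebra) := by
      rw [mul_sub, sub_mul, mul_one, Units.mul_inv]; simp
    change ((g * n * g⁻¹ : toeplitzAlgebraˣ) : toeplitzAlgebra) - 1 ∈ compactIdeal
    rw [h]
    exact compactIdeal_mul_mem_right (Ideal.mul_mem_left _ _ hn) _

/-! ### The natural Banach–Lie group structure on a quotient group -/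

/-- Let `G` be a real Banach–Lie group with a normal subgroup `K`. A (real, smooth) atlas on `G ⧸ K`
modelled on the Banach space `F`, for the quotient topology, makes `G ⧸ K` a homogeneous space
and a Banach–Lie group if `G ⧸ K` is Hausdorff, the group operations are smooth, and the quotient
map `π : G → G ⧸ K` is a submersion: it is smooth and its differential at each point is onto. -/
structure IsHomogeneousLieGroup {E F G : Type*}
    [NormedAddCommGroup E] [NormedSpace ℝ E] [NormedAddCommGroup F] [NormedSpace ℝ F]
    [Group G] [TopologicalSpace G] [ChartedSpace E G]
    (K : Subgroup G) [K.Normal] (cs : ChartedSpace F (G ⧸ K)) : Prop where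
  t2Space : T2Space (G ⧸ K)
  lieGroup : LieGroup 𝓘(ℝ, F) ∞ (G ⧸ K)
  contMDiff_mk : ContMDiff 𝓘(ℝ, E) 𝓘(ℝ, F) ∞ (QuotientGroup.mk : G → G ⧸ K)
  surjective_mfderiv_mk : ∀ g : G, Function.Surjective
    (mfderiv 𝓘(ℝ, E) 𝓘(ℝ, F) (QuotientGroup.mk : G → G ⧸ K) g)

/-- Two real Banach–Lie groups are isomorphic if there is a group isomorphism between them which is
smooth in both directions. -/
def BanachLieIsomorphic {E F G H : Type*}
    [NormedAddCommGroup E] [NormedSpace ℝ E] [NormedAddCommGroup F] [NormedSpace ℝ F]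
    [Group G] [TopologicalSpace G] [Group H] [TopologicalSpace H]
    (csG : ChartedSpace E G) (csH : ChartedSpace F H) : Prop :=
  ∃ Φ : G ≃* H, ContMDiff 𝓘(ℝ, E) 𝓘(ℝ, F) ∞ Φ ∧ ContMDiff 𝓘(ℝ, F) 𝓘(ℝ, E) ∞ Φ.symm

/-! ### Winding numbers -/

/-- `ψ` is a continuous logarithm of `φ` along the parametrisation `t ↦ exp (i t)`. -/
def IsLogLift (φ : C(Circle, ℂ)ˣ) (ψ : C(ℝ, ℂ)) : Prop :=
  ∀ t : ℝ, Complex.exp (ψ t) = (φ : C(Circle, ℂ)) (Circle.exp t)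

theorem units_apply_ne_zero (φ : C(Circle, ℂ)ˣ) (z : Circle) : (φ : C(Circle, ℂ)) z ≠ 0 := by
  intro h
  have := congrArg (fun f : C(Circle, ℂ) => f z) φ.mul_inv
  rw [ContinuousMap.mul_apply, h, zero_mul, ContinuousMap.one_apply] at this
  exact zero_ne_one this

theorem exists_isLogLift (φ : C(Circle, ℂ)ˣ) : ∃ ψ : C(ℝ, ℂ), IsLogLift φ ψ := by
  let f : C(ℝ, {z : ℂ // z ≠ 0}) :=
    ⟨fun t => ⟨(φ : C(Circle, ℂ)) (Circle.exp t), units_apply_ne_zero φ _⟩, by fun_prop⟩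
  obtain ⟨ψ, ⟨-, h⟩, -⟩ := Complex.isCoveringMap_exp.existsUnique_continuousMap_lifts f 0
    (Complex.log (f 0)) (Subtype.ext (Complex.exp_log (f 0).2))
  exact ⟨ψ, fun t => congrArg Subtype.val (congrFun h t)⟩

theorem exists_winding (φ : C(Circle, ℂ)ˣ) : ∃ n : ℤ, ∃ ψ : C(ℝ, ℂ), IsLogLift φ ψ ∧
    ψ (2 * Real.pi) - ψ 0 = n * (2 * Real.pi * Complex.I) := by
  obtain ⟨ψ, h⟩ := exists_isLogLift φ
  have : Complex.exp (ψ (2 * Real.pi)) = Complex.exp (ψ 0) := by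
    rw [h, h]; simp
  obtain ⟨n, hn⟩ := Complex.exp_eq_exp_iff_exists_int.1 this
  exact ⟨n, ψ, h, by rw [hn]; ring⟩

/-- The winding number around `0` of a nowhere vanishing continuous function `φ` on the unit
circle: the increment `(ψ(2π) - ψ(0)) / (2πi)` of a continuous logarithm `ψ` of
`t ↦ φ (exp (i t))`. -/
def windingNumber (φ : C(Circle, ℂ)ˣ) : ℤ := (exists_winding φ).choose

theorem IsLogLift.windingNumber_eq {φ : C(Circle, ℂ)ˣ} {ψ : C(ℝ, ℂ)} (h : IsLogLift φ ψ) :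
    ψ (2 * Real.pi) - ψ 0 = windingNumber φ * (2 * Real.pi * Complex.I) := by
  obtain ⟨ψ', h', e⟩ := (exists_winding φ).choose_spec
  change _ = (windingNumber φ : ℂ) * _ at e
  rw [← e]
  have key : ∀ t, ∃ n : ℤ, ψ t - ψ' t = n * (2 * Real.pi * Complex.I) := fun t => by
    obtain ⟨n, hn⟩ := Complex.exp_eq_exp_iff_exists_int.1 ((h t).trans (h' t).symm)
    exact ⟨n, by rw [hn]; ring⟩
  choose N hN using key
  have hpi : (2 * Real.pi * Complex.I : ℂ) ≠ 0 := Complex.two_pi_I_ne_zero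
  have hc : Continuous fun t => ((N t : ℤ) : ℂ) := by
    have : (fun t => ((N t : ℤ) : ℂ)) = fun t => (ψ t - ψ' t) / (2 * Real.pi * Complex.I) := by
      funext t; rw [hN]; field_simp
    rw [this]; fun_prop
  have hN' : Continuous N := by
    have hemb : Topology.IsClosedEmbedding ((↑) : ℤ → ℂ) := by
      exact Complex.isClosedEmbedding_intCast
    exact hemb.isInducing.continuous_iff.2 hc
  have hconst : N (2 * Real.pi) = N 0 :=
    PreconnectedSpace.constant inferInstance hN'
  have h1 := hN (2 * Real.pi)
  have h2 := hN 0
  rw [hconst, ← h2] at h1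
  linear_combination h1

theorem IsLogLift.windingNumber_eq_zero {φ : C(Circle, ℂ)ˣ} {ψ : C(ℝ, ℂ)} (h : IsLogLift φ ψ)
    (e : ψ (2 * Real.pi) = ψ 0) : windingNumber φ = 0 := by
  have := h.windingNumber_eq
  rw [e, sub_self, eq_comm, mul_eq_zero] at this
  exact_mod_cast this.resolve_right Complex.two_pi_I_ne_zero

theorem windingNumber_mul (φ₁ φ₂ : C(Circle, ℂ)ˣ) :
    windingNumber (φ₁ * φ₂) = windingNumber φ₁ + windingNumber φ₂ := by
  obtain ⟨ψ₁, h₁⟩ := exists_isLogLift φ₁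
  obtain ⟨ψ₂, h₂⟩ := exists_isLogLift φ₂
  have h : IsLogLift (φ₁ * φ₂) (ψ₁ + ψ₂) := fun t => by
    simp [Complex.exp_add, h₁ t, h₂ t]
  have e := h.windingNumber_eq
  have e₁ := h₁.windingNumber_eq
  have e₂ := h₂.windingNumber_eq
  have : (windingNumber (φ₁ * φ₂) : ℂ) = windingNumber φ₁ + windingNumber φ₂ := by
    apply mul_right_cancel₀ Complex.two_pi_I_ne_zero
    rw [add_mul, ← e, ← e₁, ← e₂]
    simp only [ContinuousMap.add_apply]
    ring
  exact_mod_cast this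

/-- The subgroup of `C(𝕋)ˣ` of the elements with winding number `0`. -/
def windingZero : Subgroup C(Circle, ℂ)ˣ where
  carrier := {φ | windingNumber φ = 0}
  one_mem' := by
    have := windingNumber_mul 1 1
    rw [mul_one] at this
    simp only [Set.mem_ofPred_eq]; omega
  mul_mem' := by
    intro a b ha hb
    simp only [Set.mem_ofPred_eq] at *
    rw [windingNumber_mul, ha, hb, add_zero]
  inv_mem' := by
    intro a ha
    have h1 := windingNumber_mul 1 1
    have h2 := windingNumber_mul a a⁻¹
    simp only [Set.mem_ofPred_eq, mul_one, mul_inv_cancel] at *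
    omega

theorem isOpen_windingZero : IsOpen (windingZero : Set C(Circle, ℂ)ˣ) := by
  refine Subgroup.isOpen_of_mem_nhds (g := 1) _ ?_
  have hmem : {φ : C(Circle, ℂ)ˣ | ‖(φ : C(Circle, ℂ)) - 1‖ < 1} ∈ nhds (1 : C(Circle, ℂ)ˣ) :=
    (isOpen_lt (by fun_prop) continuous_const).mem_nhds (by simp)
  filter_upwards [hmem] with φ hφ
  have hs : ∀ z, (φ : C(Circle, ℂ)) z ∈ Complex.slitPlane := fun z => by
    have := (ContinuousMap.norm_coe_le_norm ((φ : C(Circle, ℂ)) - 1) z).trans_lt hφ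
    rw [ContinuousMap.sub_apply, ContinuousMap.one_apply] at this
    refine Complex.ball_one_subset_slitPlane ?_
    simpa [dist_eq_norm] using this
  let ψ : C(ℝ, ℂ) := ⟨fun t => Complex.log ((φ : C(Circle, ℂ)) (Circle.exp t)),
    Continuous.clog (by fun_prop) fun t => hs _⟩
  exact IsLogLift.windingNumber_eq_zero (ψ := ψ)
    (fun t => Complex.exp_log (units_apply_ne_zero φ _)) (by simp [ψ])

theorem isOpenEmbedding_windingZero :
    Topology.IsOpenEmbedding fun φ : windingZero => ((φ : C(Circle, ℂ)ˣ) : C(Circle, ℂ)) :=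
  Units.isOpenEmbedding_val.comp isOpen_windingZero.isOpenEmbedding_subtypeVal

/-- `windingZero` as an open submanifold of the Banach space `C(𝕋)`. -/
instance windingZeroChartedSpace : ChartedSpace C(Circle, ℂ) windingZero :=
  isOpenEmbedding_windingZero.singletonChartedSpace

instance : LieGroup 𝓘(ℝ, C(Circle, ℂ)) ∞ windingZero := by
  have hman : IsManifold 𝓘(ℝ, C(Circle, ℂ)) ∞ windingZero :=
    isOpenEmbedding_windingZero.isManifold_singleton
  have hval : ContMDiff 𝓘(ℝ, C(Circle, ℂ)) 𝓘(ℝ, C(Circle, ℂ)) ∞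
      (fun φ : windingZero => ((φ : C(Circle, ℂ)ˣ) : C(Circle, ℂ))) :=
    contMDiff_isOpenEmbedding isOpenEmbedding_windingZero
  have hsub : ContMDiff 𝓘(ℝ, C(Circle, ℂ)) 𝓘(ℝ, C(Circle, ℂ)) ∞
      (fun φ : windingZero => (φ : C(Circle, ℂ)ˣ)) :=
    ContMDiff.of_comp_isOpenEmbedding Units.isOpenEmbedding_val hval
  exact
    { contMDiff_mul := by
        apply ContMDiff.of_comp_isOpenEmbedding isOpenEmbedding_windingZero
        exact Units.contMDiff_val.comp
          ((hsub.comp contMDiff_fst).mul (hsub.comp contMDiff_snd))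
      contMDiff_inv := by
        apply ContMDiff.of_comp_isOpenEmbedding isOpenEmbedding_windingZero
        exact Units.contMDiff_val.comp hsub.inv }

end

noncomputable section

open Filter Topology

/-! ### Multiplication operators -/

/-! The quotient is computed by the symbol map `T_φ + k ↦ φ`, a split homomorphism from the Toeplitz
algebra onto `C(𝕋)` whose kernel is the ideal of compact operators.

Two facts make it exist. Hankel operators with continuous symbol are compact
(`isCompactOperator_hankel`), so `φ ↦ T_φ` is multiplicative modulo compacts. Moreover `‖φ‖ ≤ ‖T_φ +
k‖` for compact `k` (`norm_le_norm_toeplitz_add_compact`): compressing by powers of the shift fixes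
`T_φ` and kills `k` strongly, while quadratic forms at peak functions recover the values of `φ`.
Hence symbols are unique and contractive, and the algebra of operators `T_φ + k` is closed, so it
contains the Toeplitz algebra.

On units, the image is exactly winding number zero. Such a function is `exp ψ` and lifts to `exp
T_ψ`. Conversely, after multiplication by liftable functions, an invertible element with nonzero
winding number would give one with symbol `zⁿ`, `n ≠ 0`, which the Fredholm alternative excludes
(`windingNumber_symbol`). So `G/K` is topologically isomorphic to `windingZero`; pulling back its
chart gives existence, and commutativity is inherited.

For an arbitrary admissible smooth structure, the linear section `φ ↦ T_φ` gives smooth local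
sections of `G → windingZero`, so the inverse isomorphism `windingZero → G/K` is smooth. Its
differential is onto because that of `π` is, and injective by a one-parameter subgroup argument
(`injective_mfderiv_quotient_equiv_symm`). The inverse function theorem then makes the isomorphism
smooth in both directions. -/

theorem mulOperator_add (φ ψ : C(Circle, ℂ)) :
    mulOperator (φ + ψ) = mulOperator φ + mulOperator ψ := by
  simp [mulOperator]

theorem mulOperator_smul (c : ℂ) (φ : C(Circle, ℂ)) :
    mulOperator (c • φ) = c • mulOperator φ := by
  simp [mulOperator]

theorem continuous_mulOperator : Continuous mulOperator := by
  unfold mulOperator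
  fun_prop

theorem mulOperator_one : mulOperator 1 = 1 := by
  ext1 f
  apply Lp.ext
  filter_upwards [mulOperator_coeFn 1 f] with z hz
  simp [hz]

theorem mulOperator_mul (φ ψ : C(Circle, ℂ)) :
    mulOperator (φ * ψ) = mulOperator φ * mulOperator ψ := by
  ext1 f
  apply Lp.ext
  filter_upwards [mulOperator_coeFn (φ * ψ) f, mulOperator_coeFn φ (mulOperator ψ f),
    mulOperator_coeFn ψ f] with z h1 h2 h3
  rw [mul_apply_eq_comp, h1, h2, h3, ContinuousMap.mul_apply, mul_assoc]

theorem mulOperator_toLp (φ ψ : C(Circle, ℂ)) :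
    mulOperator φ (ContinuousMap.toLp 2 circleMeasure ℂ ψ) =
      ContinuousMap.toLp 2 circleMeasure ℂ (φ * ψ) := by
  apply Lp.ext
  filter_upwards [mulOperator_coeFn φ (ContinuousMap.toLp 2 circleMeasure ℂ ψ),
    ContinuousMap.coeFn_toLp (p := 2) (𝕜 := ℂ) circleMeasure ψ,
    ContinuousMap.coeFn_toLp (p := 2) (𝕜 := ℂ) circleMeasure (φ * ψ)] with z h1 h2 h3
  rw [h1, h2, h3, ContinuousMap.mul_apply]

theorem inner_mulOperator_left (φ : C(Circle, ℂ)) (f g : L2Circle) :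
    inner ℂ (mulOperator φ f) g = inner ℂ f (mulOperator (star φ) g) := by
  rw [L2.inner_def, L2.inner_def]
  apply integral_congr_ae
  filter_upwards [mulOperator_coeFn φ f, mulOperator_coeFn (star φ) g] with z h1 h2
  rw [h1, h2]
  simp [mul_left_comm, mul_comm]

/-! ### The Hardy space -/

theorem hardyProjection_hardyInclusion (f : HardySpace) :
    hardyProjection (hardyInclusion f) = f :=
  hardySubspace.orthogonalProjectionOnto_mem_subspace_eq_self f

theorem hardyInclusion_hardyProjection {f : L2Circle} (hf : f ∈ hardySubspace) :
    hardyInclusion (hardyProjection f) = f :=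
  congrArg Subtype.val (hardySubspace.orthogonalProjectionOnto_mem_subspace_eq_self ⟨f, hf⟩)

theorem hardyInclusion_mem (f : HardySpace) : hardyInclusion f ∈ hardySubspace := f.2

theorem inner_hardyProjection_left (f : L2Circle) (g : HardySpace) :
    inner ℂ (hardyProjection f) g = inner ℂ f (hardyInclusion g) :=
  (hardySubspace.inner_orthogonalProjectionOnto_eq_of_mem_right g f)

theorem inner_hardyProjection_right (f : HardySpace) (g : L2Circle) :
    inner ℂ f (hardyProjection g) = inner ℂ (hardyInclusion f) g :=
  (hardySubspace.inner_orthogonalProjectionOnto_eq_of_mem_left f g)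

theorem norm_hardyProjection_le (f : L2Circle) : ‖hardyProjection f‖ ≤ ‖f‖ :=
  hardySubspace.norm_orthogonalProjectionOnto_apply_le f

theorem toLp_monomial_mem (n : ℕ) :
    ContinuousMap.toLp 2 circleMeasure ℂ (monomial n) ∈ hardySubspace :=
  Submodule.le_topologicalClosure _ (Submodule.subset_span ⟨n, rfl⟩)

/-- A closed subspace of `L²(𝕋)` containing all `χₙ`, `n ≥ 0`, contains `H²`. -/
theorem hardySubspace_le {C : Submodule ℂ L2Circle} (hC : IsClosed (C : Set L2Circle))
    (h : ∀ n : ℕ, ContinuousMap.toLp 2 circleMeasure ℂ (monomial n) ∈ C) :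
    hardySubspace ≤ C :=
  Submodule.topologicalClosure_minimal _ (Submodule.span_le.2 (by rintro _ ⟨n, rfl⟩; exact h n)) hC

/-- The function `χₙ`, `n ≥ 0`, as an element of the Hardy space. -/
def hardyMonomial (n : ℕ) : HardySpace := ⟨_, toLp_monomial_mem n⟩

theorem hardyInclusion_hardyMonomial (n : ℕ) : hardyInclusion (hardyMonomial n) =
    ContinuousMap.toLp 2 circleMeasure ℂ (monomial n) := rfl

theorem eq_top_of_hardyMonomial_mem {C : Submodule ℂ HardySpace}
    (hC : IsClosed (C : Set HardySpace)) (h : ∀ n, hardyMonomial n ∈ C) : C = ⊤ := by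
  have hcl :
      IsClosed ((C.map hardyInclusion.toLinearMap : Submodule ℂ L2Circle) : Set L2Circle) := by
    rw [Submodule.map_coe]
    exact hardyInclusion.isometry.isClosedEmbedding.isClosedMap _ hC
  have hle := hardySubspace_le hcl fun n => ⟨hardyMonomial n, h n, rfl⟩
  refine eq_top_iff.2 fun f _ => ?_
  obtain ⟨g, hg, hgf⟩ := hle (hardyInclusion_mem f)
  exact hardyInclusion.injective hgf ▸ hg

theorem monomial_add (m n : ℤ) : monomial (m + n) = monomial m * monomial n := by
  ext z
  simp [monomial, zpow_add]

theorem monomial_zero : monomial 0 = 1 := by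
  ext z
  simp [monomial]

theorem monomial_apply (n : ℤ) (z : Circle) : monomial n z = (z : ℂ) ^ n := by
  simp [monomial]

theorem star_monomial (n : ℤ) : star (monomial n) = monomial (-n) := by
  ext z
  simp [monomial, ← Circle.coe_inv_eq_conj]

theorem mulOperator_monomial_mem (n : ℕ) {f : L2Circle} (hf : f ∈ hardySubspace) :
    mulOperator (monomial n) f ∈ hardySubspace := by
  have hcl : IsClosed ((hardySubspace.comap (mulOperator (monomial n)).toLinearMap :
      Submodule ℂ L2Circle) : Set L2Circle) :=
    (Submodule.isClosed_topologicalClosure _).preimage (mulOperator (monomial n)).continuous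
  refine hardySubspace_le hcl (fun m => ?_) hf
  rw [Submodule.mem_comap, ContinuousLinearMap.coe_coe, mulOperator_toLp, ← monomial_add]
  exact_mod_cast toLp_monomial_mem (n + m)

/-! ### Toeplitz and Hankel operators -/

theorem toeplitz_apply (φ : C(Circle, ℂ)) (f : HardySpace) :
    toeplitz φ f = hardyProjection (mulOperator φ (hardyInclusion f)) := rfl

theorem toeplitz_add (φ ψ : C(Circle, ℂ)) : toeplitz (φ + ψ) = toeplitz φ + toeplitz ψ := by
  ext f
  simp [toeplitz_apply, mulOperator_add]

theorem toeplitz_smul (c : ℂ) (φ : C(Circle, ℂ)) : toeplitz (c • φ) = c • toeplitz φ := by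
  ext f
  simp [toeplitz_apply, mulOperator_smul]

theorem toeplitz_one : toeplitz 1 = 1 := by
  ext f
  simp [toeplitz_apply, mulOperator_one, hardyProjection_hardyInclusion]

theorem toeplitz_star (φ : C(Circle, ℂ)) : toeplitz (star φ) = star (toeplitz φ) := by
  rw [ContinuousLinearMap.star_eq_adjoint, ContinuousLinearMap.eq_adjoint_iff]
  intro f g
  rw [toeplitz_apply, toeplitz_apply, inner_hardyProjection_left, inner_mulOperator_left,
    star_star, inner_hardyProjection_right]

/-- `φ ↦ T_φ` as a continuous linear map. -/
def toeplitzCLM : C(Circle, ℂ) →L[ℂ] (HardySpace →L[ℂ] HardySpace) where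
  toFun := toeplitz
  map_add' := toeplitz_add
  map_smul' := toeplitz_smul
  cont := by
    have := continuous_mulOperator
    unfold toeplitz
    fun_prop

/-- The (generalised) Hankel operator `f ↦ (1 - P) (φ f)`. -/
def hankel (φ : C(Circle, ℂ)) : HardySpace →L[ℂ] L2Circle :=
  mulOperator φ ∘L hardyInclusion.toContinuousLinearMap -
    hardyInclusion.toContinuousLinearMap ∘L toeplitz φ

theorem hankel_apply (φ : C(Circle, ℂ)) (f : HardySpace) :
    hankel φ f = mulOperator φ (hardyInclusion f) - hardyInclusion (toeplitz φ f) := rfl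

/-- Splitting `ψ f` into its `H²` part and the remainder shows that the failure of multiplicativity
factors through a Hankel operator, hence is compact once Hankel operators are. -/
theorem toeplitz_mul (φ ψ : C(Circle, ℂ)) : toeplitz (φ * ψ) =
    toeplitz φ * toeplitz ψ + hardyProjection ∘L mulOperator φ ∘L hankel ψ := by
  ext f
  simp [toeplitz_apply, hankel_apply, mulOperator_mul]

/-- Every term contains a Hankel factor, so the symbols with compact Hankel operator are closed
under products. -/
theorem hankel_mul (φ ψ : C(Circle, ℂ)) : hankel (φ * ψ) =
    hankel φ ∘L toeplitz ψ + mulOperator φ ∘L hankel ψ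
      - hardyInclusion.toContinuousLinearMap ∘L hardyProjection ∘L mulOperator φ ∘L hankel ψ := by
  ext f
  simp [toeplitz_apply, hankel_apply, mulOperator_mul]

/-- `φ ↦ hankel φ` as a continuous linear map. -/
def hankelCLM : C(Circle, ℂ) →L[ℂ] (HardySpace →L[ℂ] L2Circle) where
  toFun := hankel
  map_add' φ ψ := by
    ext1 f
    simp only [hankel_apply, mulOperator_add, toeplitz_add, add_apply, map_add]
    abel
  map_smul' c φ := by
    ext1 f
    simp only [hankel_apply, mulOperator_smul, toeplitz_smul, smul_apply,
      map_smul, smul_sub, RingHom.id_apply]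
  cont := by
    have := continuous_mulOperator
    have : Continuous toeplitz := toeplitzCLM.continuous
    unfold hankel
    fun_prop

theorem hankel_monomial (n : ℕ) : hankel (monomial n) = 0 := by
  ext1 f
  rw [hankel_apply, toeplitz_apply, hardyInclusion_hardyProjection
    (mulOperator_monomial_mem n (hardyInclusion_mem f)), sub_self, zero_apply]

theorem hankel_apply_eq_zero {φ : C(Circle, ℂ)} {f : HardySpace}
    (h : mulOperator φ (hardyInclusion f) ∈ hardySubspace) : hankel φ f = 0 := by
  rw [hankel_apply, toeplitz_apply, hardyInclusion_hardyProjection h, sub_self]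

/-! ### Compactness of Hankel operators -/

/-- Multiplication by `z⁻¹` sends `χₙ₊₁` to `χₙ`, so only `χ₀` can leave `H²` and the operator has
rank at most one. -/
theorem isCompactOperator_hankel_monomial_neg_one :
    IsCompactOperator (hankel (monomial (-1))) := by
  let V : Submodule ℂ L2Circle := Submodule.span ℂ {hankel (monomial (-1)) (hardyMonomial 0)}
  have hV : V.comap (hankel (monomial (-1))).toLinearMap = ⊤ := by
    refine eq_top_of_hardyMonomial_mem
      (V.closed_of_finiteDimensional.preimage (hankel (monomial (-1))).continuous) fun n => ?_
    rw [Submodule.mem_comap, ContinuousLinearMap.coe_coe]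
    rcases n with _ | n
    · exact Submodule.mem_span_singleton_self _
    · rw [hankel_apply_eq_zero]
      · exact zero_mem _
      · rw [hardyInclusion_hardyMonomial, mulOperator_toLp, ← monomial_add]
        have : (-1 + ((n + 1 : ℕ) : ℤ)) = n := by push_cast; ring
        rw [this]
        exact toLp_monomial_mem n
  have hmem : ∀ f, hankel (monomial (-1)) f ∈ V := fun f => by
    have : f ∈ V.comap (hankel (monomial (-1))).toLinearMap := hV ▸ Submodule.mem_top
    exact this
  have : IsCompactOperator ((hankel (monomial (-1))).codRestrict V hmem) :=
    have : ProperSpace V := FiniteDimensional.proper ℂ V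
    isCompactOperator_of_locallyCompactSpace_dom _
  exact this.clm_comp V.subtypeL

/-- Stone–Weierstrass: the symbols with compact Hankel operator form a closed subalgebra containing
`z` and `z⁻¹ = z̄`. -/
theorem isCompactOperator_hankel (φ : C(Circle, ℂ)) : IsCompactOperator (hankel φ) := by
  let A : Subalgebra ℂ C(Circle, ℂ) :=
    { carrier := {φ | IsCompactOperator (hankel φ)}
      mul_mem' := by
        intro φ ψ hφ hψ
        rw [Set.mem_ofPred_eq, hankel_mul]
        have h1 := hφ.comp_clm (toeplitz ψ)
        have h2 := hψ.clm_comp (mulOperator φ)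
        exact (h1.add h2).sub (h2.clm_comp
          (hardyInclusion.toContinuousLinearMap ∘L hardyProjection))
      add_mem' := by
        intro φ ψ hφ hψ
        have := hankelCLM.map_add φ ψ
        change hankel (φ + ψ) = hankel φ + hankel ψ at this
        rw [Set.mem_ofPred_eq, this]
        exact hφ.add hψ
      algebraMap_mem' := by
        intro c
        have := hankelCLM.map_smul c 1
        change hankel (c • 1) = c • hankel 1 at this
        rw [Set.mem_ofPred_eq, Algebra.algebraMap_eq_smul_one, this, ← monomial_zero]
        have h0 := hankel_monomial 0
        rw [Nat.cast_zero] at h0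
        rw [h0, smul_zero]
        exact isCompactOperator_zero }
  have hA : IsClosed (A : Set C(Circle, ℂ)) :=
    isClosed_setOfPred_isCompactOperator.preimage hankelCLM.continuous
  let S : StarSubalgebra ℂ C(Circle, ℂ) := StarAlgebra.adjoin ℂ {monomial 1}
  have hS : S.topologicalClosure = ⊤ := by
    apply ContinuousMap.starSubalgebra_topologicalClosure_eq_top_of_separatesPoints
    intro x y hxy
    refine ⟨monomial 1, ⟨monomial 1, StarAlgebra.self_mem_adjoin_singleton _ _, rfl⟩, ?_⟩
    simpa [monomial_apply, Circle.ext_iff] using hxy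
  have hSA : S.toSubalgebra ≤ A := by
    rw [StarAlgebra.adjoin_toSubalgebra]
    refine Algebra.adjoin_le ?_
    rintro ψ (rfl | h)
    · have := hankel_monomial 1
      rw [Nat.cast_one] at this
      change IsCompactOperator (hankel _)
      rw [this]
      exact isCompactOperator_zero
    · rw [Set.mem_star, Set.mem_singleton_iff, star_eq_iff_star_eq, star_monomial] at h
      exact h ▸ isCompactOperator_hankel_monomial_neg_one
  have hφ : φ ∈ S.topologicalClosure := hS ▸ trivial
  have hφ' : φ ∈ closure (S : Set C(Circle, ℂ)) := hφ
  exact closure_minimal hSA hA hφ'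

theorem isCompactOperator_toeplitz_mul_sub (φ ψ : C(Circle, ℂ)) :
    IsCompactOperator (toeplitz φ * toeplitz ψ - toeplitz (φ * ψ)) := by
  rw [toeplitz_mul, sub_add_cancel_left]
  exact ((isCompactOperator_hankel ψ).clm_comp (hardyProjection ∘L mulOperator φ)).neg

/-! ### Orthogonality of monomials and compression by the shift -/

instance : circleMeasure.IsHaarMeasure :=
  inferInstanceAs (Measure.haarMeasure _).IsHaarMeasure

/-- Rotation by `exp (iπ/n)` preserves the measure and multiplies the integrand by `-1`. -/
theorem integral_monomial {n : ℤ} (hn : n ≠ 0) : ∫ z, monomial n z ∂circleMeasure = 0 := by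
  have hw : (Circle.exp (Real.pi / n) : ℂ) ^ n = -1 := by
    rw [Circle.coe_exp, ← Complex.exp_int_mul, ← Complex.exp_pi_mul_I]
    congr 1
    have : (n : ℂ) ≠ 0 := by exact_mod_cast hn
    push_cast
    field_simp
  have h := integral_mul_left_eq_self (μ := circleMeasure) (fun z => monomial n z)
    (Circle.exp (Real.pi / n))
  simp only [monomial_apply, Circle.coe_mul, mul_zpow, hw, integral_const_mul] at h ⊢
  linear_combination (-1 / 2 : ℂ) * h

theorem inner_toLp (φ ψ : C(Circle, ℂ)) :
    inner ℂ (ContinuousMap.toLp 2 circleMeasure ℂ φ) (ContinuousMap.toLp 2 circleMeasure ℂ ψ) =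
      ∫ z, ψ z * star (φ z) ∂circleMeasure :=
  ContinuousMap.inner_toLp circleMeasure φ ψ

theorem inner_toLp_monomial {m n : ℤ} (h : m ≠ n) :
    inner ℂ (ContinuousMap.toLp 2 circleMeasure ℂ (monomial m))
      (ContinuousMap.toLp 2 circleMeasure ℂ (monomial n)) = 0 := by
  rw [inner_toLp, ← integral_monomial (n := n + -m) (by omega), monomial_add, ← star_monomial]
  rfl

theorem toLp_monomial_mem_orthogonal {n : ℤ} (hn : n < 0) :
    ContinuousMap.toLp 2 circleMeasure ℂ (monomial n) ∈ hardySubspaceᗮ := by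
  have : hardySubspace ≤ (ℂ ∙ ContinuousMap.toLp 2 circleMeasure ℂ (monomial n))ᗮ := by
    refine hardySubspace_le (Submodule.isClosed_orthogonal _) fun m => ?_
    rw [Submodule.mem_orthogonal_singleton_iff_inner_right]
    exact inner_toLp_monomial (by omega)
  exact Submodule.le_orthogonal_iff_le_orthogonal.1 this (Submodule.mem_span_singleton_self _)

theorem toeplitz_monomial_neg_hardyMonomial {m j : ℕ} (h : j < m) :
    toeplitz (monomial (-m)) (hardyMonomial j) = 0 := by
  rw [toeplitz_apply, hardyInclusion_hardyMonomial, mulOperator_toLp, ← monomial_add]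
  exact hardySubspace.orthogonalProjectionOnto_eq_zero_iff.2
    (toLp_monomial_mem_orthogonal (by omega))

theorem norm_mulOperator_monomial (n : ℤ) (f : L2Circle) :
    ‖mulOperator (monomial n) f‖ = ‖f‖ := by
  rw [← sq_eq_sq₀ (norm_nonneg _) (norm_nonneg _), ← inner_self_eq_norm_sq (𝕜 := ℂ),
    ← inner_self_eq_norm_sq (𝕜 := ℂ), inner_mulOperator_left, ← mul_apply_eq_comp,
    ← mulOperator_mul, star_monomial, ← monomial_add, neg_add_cancel, monomial_zero,
    mulOperator_one, one_apply_eq_self]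

theorem norm_toeplitz_monomial_le (n : ℤ) (f : HardySpace) :
    ‖toeplitz (monomial n) f‖ ≤ ‖f‖ := by
  rw [toeplitz_apply]
  refine (norm_hardyProjection_le _).trans ?_
  rw [norm_mulOperator_monomial, LinearIsometry.norm_map]

theorem toeplitz_mul_monomial (φ : C(Circle, ℂ)) (n : ℕ) :
    toeplitz (φ * monomial n) = toeplitz φ * toeplitz (monomial n) := by
  rw [toeplitz_mul, hankel_monomial, ContinuousLinearMap.comp_zero, ContinuousLinearMap.comp_zero,
    add_zero]

theorem toeplitz_monomial_neg_mul (φ : C(Circle, ℂ)) (n : ℕ) :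
    toeplitz (monomial (-n) * φ) = toeplitz (monomial (-n)) * toeplitz φ := by
  have h := congrArg star (toeplitz_mul_monomial (star φ) n)
  rwa [star_mul, ← toeplitz_star, ← toeplitz_star, ← toeplitz_star, star_mul, star_star,
    star_monomial] at h

/-- Products with an analytic factor on the right or a coanalytic one on the left are exact, so
Toeplitz operators are invariant under compression by the shift. -/
theorem toeplitz_monomial_conj (φ : C(Circle, ℂ)) (n : ℕ) :
    toeplitz (monomial (-n)) * toeplitz φ * toeplitz (monomial n) = toeplitz φ := by
  rw [← toeplitz_monomial_neg_mul, ← toeplitz_mul_monomial, mul_right_comm, ← monomial_add,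
    neg_add_cancel, monomial_zero, one_mul]

/-- The powers of the backward shift tend to zero strongly. -/
theorem tendsto_toeplitz_monomial_neg (f : HardySpace) :
    Tendsto (fun m : ℕ => toeplitz (monomial (-m)) f) atTop (𝓝 0) := by
  let C : Submodule ℂ HardySpace :=
    { carrier := {f | Tendsto (fun m : ℕ => toeplitz (monomial (-m)) f) atTop (𝓝 0)}
      zero_mem' := by simp
      add_mem' := fun {f g} hf hg => by
        simpa using Tendsto.add hf hg
      smul_mem' := fun c f hf => by
        simpa using Tendsto.const_smul hf c }
  -- Strong convergence passes to limits of vectors because all these operators are contractions.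
  have hC : IsClosed (C : Set HardySpace) := by
    refine isClosed_of_closure_subset fun f hf => ?_
    change Tendsto _ _ _
    rw [Metric.tendsto_atTop]
    intro ε hε
    obtain ⟨g, hg, hfg⟩ := Metric.mem_closure_iff.1 hf (ε / 2) (half_pos hε)
    obtain ⟨N, hN⟩ := Metric.tendsto_atTop.1 (show Tendsto _ _ _ from hg) (ε / 2) (half_pos hε)
    refine ⟨N, fun m hm => ?_⟩
    have h1 := hN m hm
    have h2 := norm_toeplitz_monomial_le (-m) (f - g)
    rw [dist_zero_right] at h1 ⊢
    rw [dist_eq_norm] at hfg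
    have h3 : toeplitz (monomial (-m)) f =
      toeplitz (monomial (-m)) (f - g) + toeplitz (monomial (-m)) g := by rw [map_sub]; abel
    rw [h3]
    refine (norm_add_le _ _).trans_lt ?_
    linarith
  have htop : C = ⊤ := eq_top_of_hardyMonomial_mem hC fun j => by
    refine tendsto_const_nhds.congr' ?_
    filter_upwards [eventually_gt_atTop j] with m hm
    exact (toeplitz_monomial_neg_hardyMonomial hm).symm
  exact (htop ▸ Submodule.mem_top : f ∈ C)

/-- Compressing a compact operator by powers of the shift yields operators tending strongly to
zero. -/
theorem tendsto_compress_compact {k : HardySpace →L[ℂ] HardySpace} (hk : IsCompactOperator k)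
    (f : HardySpace) :
    Tendsto (fun m : ℕ => toeplitz (monomial (-m)) (k (toeplitz (monomial m) f))) atTop (𝓝 0) := by
  rw [Metric.tendsto_atTop]
  intro ε hε
  -- The shifted vectors stay in the ball of radius `‖f‖`, so their images under `k` lie in one
  -- compact set. A finite `ε/2`-net and contractivity make the strong convergence uniform there.
  obtain ⟨C, hC, hkC⟩ := hk.image_closedBall_subset_compact ‖f‖
  obtain ⟨t, -, ht, htC⟩ := hC.finite_cover_balls (half_pos hε)
  have hev : ∀ᶠ m : ℕ in atTop, ∀ g ∈ t, ‖toeplitz (monomial (-m)) g‖ < ε / 2 := by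
    rw [eventually_all_finite ht]
    intro g _
    have := (tendsto_toeplitz_monomial_neg g).norm
    rw [norm_zero] at this
    exact this.eventually_lt_const (half_pos hε)
  obtain ⟨N, hN⟩ := eventually_atTop.1 hev
  refine ⟨N, fun m hm => ?_⟩
  have hmem : k (toeplitz (monomial m) f) ∈ C := hkC ⟨_, by
    simpa using norm_toeplitz_monomial_le m f, rfl⟩
  obtain ⟨g, hg, hkg⟩ := Set.mem_iUnion₂.1 (htC hmem)
  rw [Metric.mem_ball, dist_eq_norm] at hkg
  have h1 := hN m hm g hg
  have h2 := norm_toeplitz_monomial_le (-m) (k (toeplitz (monomial m) f) - g)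
  have h3 : toeplitz (monomial (-m)) (k (toeplitz (monomial m) f)) =
    toeplitz (monomial (-m)) (k (toeplitz (monomial m) f) - g) + toeplitz (monomial (-m)) g := by
    rw [map_sub]; abel
  rw [dist_zero_right, h3]
  refine (norm_add_le _ _).trans_lt ?_
  linarith

theorem norm_toeplitz_le_norm_add_compact (φ : C(Circle, ℂ)) {k : HardySpace →L[ℂ] HardySpace}
    (hk : IsCompactOperator k) : ‖toeplitz φ‖ ≤ ‖toeplitz φ + k‖ := by
  refine ContinuousLinearMap.opNorm_le_bound _ (norm_nonneg _) fun f => ?_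
  have hlim : Tendsto (fun m : ℕ => ‖toeplitz φ f +
      toeplitz (monomial (-m)) (k (toeplitz (monomial m) f))‖) atTop (𝓝 ‖toeplitz φ f‖) := by
    simpa using (tendsto_const_nhds.add (tendsto_compress_compact hk f)).norm
  refine le_of_tendsto' hlim fun m => ?_
  have h : toeplitz φ f + toeplitz (monomial (-m)) (k (toeplitz (monomial m) f)) =
      toeplitz (monomial (-m)) ((toeplitz φ + k) (toeplitz (monomial m) f)) := by
    conv_lhs => rw [← toeplitz_monomial_conj φ m]
    simp
  rw [h]
  refine (norm_toeplitz_monomial_le _ _).trans ((ContinuousLinearMap.le_opNorm _ _).trans ?_)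
  exact mul_le_mul_of_nonneg_left (norm_toeplitz_monomial_le _ _) (norm_nonneg _)

/-! ### Peak functions -/

/-- The function `z ↦ 1 + w̄ z`, whose modulus is maximal exactly at `w`. -/
def peak (w : Circle) : C(Circle, ℂ) := monomial 0 + ((w⁻¹ : Circle) : ℂ) • monomial 1

theorem toLp_peak_pow_mem (w : Circle) (n : ℕ) :
    ContinuousMap.toLp 2 circleMeasure ℂ (peak w ^ n) ∈ hardySubspace := by
  induction n with
  | zero =>
    rw [pow_zero, ← monomial_zero]
    exact_mod_cast toLp_monomial_mem 0
  | succ n ih =>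
    rw [pow_succ', ← mulOperator_toLp, peak, mulOperator_add, mulOperator_smul]
    exact add_mem (by exact_mod_cast mulOperator_monomial_mem 0 ih)
      (Submodule.smul_mem _ _ (by exact_mod_cast mulOperator_monomial_mem 1 ih))

theorem peak_apply (w z : Circle) : peak w z = 1 + ((w⁻¹ * z : Circle) : ℂ) := by
  simp [peak, monomial_apply]

theorem normSq_peak (w z : Circle) : ‖peak w z‖ ^ 2 = 2 + 2 * ((w⁻¹ * z : Circle) : ℂ).re := by
  have h := Circle.normSq_coe (w⁻¹ * z)
  rw [peak_apply, ← Complex.normSq_eq_norm_sq, Complex.normSq_apply]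
  rw [Complex.normSq_apply] at h
  simp only [Complex.add_re, Complex.one_re, Complex.add_im, Complex.one_im]
  linear_combination h

theorem normSq_peak_lt {w z : Circle} (h : z ≠ w) : ‖peak w z‖ ^ 2 < ‖peak w w‖ ^ 2 := by
  rw [normSq_peak, normSq_peak, inv_mul_cancel, Circle.coe_one, Complex.one_re]
  have h1 : ((w⁻¹ * z : Circle) : ℂ).re ≤ 1 :=
    (Complex.re_le_norm _).trans (Circle.norm_coe _).le
  rcases h1.lt_or_eq with h1 | h1
  · linarith
  · exfalso
    have h2 := Circle.normSq_coe (w⁻¹ * z)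
    rw [Complex.normSq_apply, h1] at h2
    have him : ((w⁻¹ * z : Circle) : ℂ).im = 0 := by nlinarith
    have : w⁻¹ * z = 1 := Circle.ext (Complex.ext h1 him)
    exact h (inv_mul_eq_one.1 this).symm

/-- For `f = (peak w)ⁿ`, the quotient `⟪f, T_φ f⟫ / ‖f‖²` is the average of `φ` against the density
proportional to `|peak w|²ⁿ`. It is bounded by `‖T_φ‖`, and the mass concentrates at `w` as `n → ∞`.
-/
theorem norm_apply_le_norm_toeplitz (φ : C(Circle, ℂ)) (w : Circle) : ‖φ w‖ ≤ ‖toeplitz φ‖ := by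
  let c : Circle → ℝ := fun z => ‖peak w z‖ ^ 2
  have hcont : Continuous c := by fun_prop
  have hpos : 0 < c w := by
    simp only [c]
    rw [normSq_peak, inv_mul_cancel]
    norm_num
  have hlim := tendsto_setIntegral_pow_smul_of_unique_maximum_of_isCompact_of_continuousOn
    (μ := circleMeasure) (s := Set.univ) (x₀ := w) (c := c) (g := φ) isCompact_univ
    hcont.continuousOn (fun z _ hz => normSq_peak_lt hz) (fun z _ => by positivity)
    hpos (by simp) φ.continuous.continuousOn
  simp only [setIntegral_univ] at hlim
  refine le_of_tendsto' hlim.norm fun n => ?_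
  let f : HardySpace := ⟨_, toLp_peak_pow_mem w n⟩
  have hf : hardyInclusion f = ContinuousMap.toLp 2 circleMeasure ℂ (peak w ^ n) := rfl
  have hc : ∀ z, ((c z ^ n : ℝ) : ℂ) = (peak w ^ n) z * star ((peak w ^ n) z) := fun z => by
    have : ((c z : ℝ) : ℂ) = peak w z * star (peak w z) := by
      simp [c, Complex.mul_conj, Complex.normSq_eq_norm_sq]
    rw [Complex.ofReal_pow, this, ContinuousMap.pow_apply, star_pow, mul_pow]
  have h1 : inner ℂ f (toeplitz φ f) = ∫ z, c z ^ n • φ z ∂circleMeasure := by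
    rw [toeplitz_apply, inner_hardyProjection_right, hf, mulOperator_toLp, inner_toLp]
    congr 1 with z
    rw [Complex.real_smul, hc, ContinuousMap.mul_apply]
    ring
  have h2 : ((‖f‖ ^ 2 : ℝ) : ℂ) = ((∫ z, c z ^ n ∂circleMeasure : ℝ) : ℂ) := by
    rw [← integral_complex_ofReal, ← hardyInclusion.norm_map, hf, Complex.ofReal_pow]
    have h := inner_self_eq_norm_sq_to_K (𝕜 := ℂ)
      (ContinuousMap.toLp 2 circleMeasure ℂ (peak w ^ n))
    rw [inner_toLp] at h
    exact h.symm.trans (integral_congr_ae (ae_of_all _ fun z => (hc z).symm))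
  have h2' : ‖f‖ ^ 2 = ∫ z, c z ^ n ∂circleMeasure := Complex.ofReal_injective h2
  rw [norm_smul, ← h1, ← h2', norm_inv, norm_pow, norm_norm, inv_mul_le_iff₀']
  · calc ‖inner ℂ f (toeplitz φ f)‖ ≤ ‖f‖ * ‖toeplitz φ f‖ := norm_inner_le_norm _ _
      _ ≤ ‖f‖ * (‖toeplitz φ‖ * ‖f‖) := by gcongr; exact (toeplitz φ).le_opNorm f
      _ = ‖toeplitz φ‖ * ‖f‖ ^ 2 := by ring
  · rw [h2', integral_pos_iff_support_of_nonneg (fun z => by positivity)]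
    · refine IsOpen.measure_pos _ (hcont.pow n).isOpen_support ⟨w, ?_⟩
      exact pow_ne_zero _ hpos.ne'
    · exact (hcont.pow n).integrable_of_hasCompactSupport (HasCompactSupport.of_compactSpace _)

theorem norm_le_norm_toeplitz (φ : C(Circle, ℂ)) : ‖φ‖ ≤ ‖toeplitz φ‖ :=
  (ContinuousMap.norm_le _ (norm_nonneg _)).2 (norm_apply_le_norm_toeplitz φ)

theorem norm_le_norm_toeplitz_add_compact (φ : C(Circle, ℂ)) {k : HardySpace →L[ℂ] HardySpace}
    (hk : IsCompactOperator k) : ‖φ‖ ≤ ‖toeplitz φ + k‖ :=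
  (norm_le_norm_toeplitz φ).trans (norm_toeplitz_le_norm_add_compact φ hk)

/-! ### The symbol map of the Toeplitz algebra -/

theorem norm_sub_le_of_isCompactOperator {A B : HardySpace →L[ℂ] HardySpace} {φ ψ : C(Circle, ℂ)}
    (hA : IsCompactOperator (A - toeplitz φ)) (hB : IsCompactOperator (B - toeplitz ψ)) :
    ‖φ - ψ‖ ≤ ‖A - B‖ := by
  have h := norm_le_norm_toeplitz_add_compact (φ - ψ)
    (k := (A - toeplitz φ) - (B - toeplitz ψ)) (hA.sub hB)
  have e : toeplitz (φ - ψ) = toeplitz φ - toeplitz ψ := toeplitzCLM.map_sub φ ψ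
  have e' : toeplitz φ - toeplitz ψ + ((A - toeplitz φ) - (B - toeplitz ψ)) = A - B := by abel
  rwa [e, e'] at h

theorem eq_of_isCompactOperator_sub_toeplitz {A : HardySpace →L[ℂ] HardySpace}
    {φ ψ : C(Circle, ℂ)} (hφ : IsCompactOperator (A - toeplitz φ))
    (hψ : IsCompactOperator (A - toeplitz ψ)) : φ = ψ := by
  have := norm_sub_le_of_isCompactOperator hφ hψ
  rw [sub_self, norm_zero] at this
  exact sub_eq_zero.1 (norm_le_zero_iff.1 this)

theorem isCompactOperator_mul_sub_toeplitz {A B : HardySpace →L[ℂ] HardySpace}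
    {φ ψ : C(Circle, ℂ)} (hA : IsCompactOperator (A - toeplitz φ))
    (hB : IsCompactOperator (B - toeplitz ψ)) :
    IsCompactOperator (A * B - toeplitz (φ * ψ)) := by
  have e : A * B - toeplitz (φ * ψ) = (A - toeplitz φ) * B + toeplitz φ * (B - toeplitz ψ)
      + (toeplitz φ * toeplitz ψ - toeplitz (φ * ψ)) := by noncomm_ring
  rw [e]
  exact ((hA.comp_clm B).add (hB.clm_comp (toeplitz φ))).add
    (isCompactOperator_toeplitz_mul_sub φ ψ)

theorem isCompactOperator_add_sub_toeplitz {A B : HardySpace →L[ℂ] HardySpace}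
    {φ ψ : C(Circle, ℂ)} (hA : IsCompactOperator (A - toeplitz φ))
    (hB : IsCompactOperator (B - toeplitz ψ)) :
    IsCompactOperator (A + B - toeplitz (φ + ψ)) := by
  rw [toeplitz_add, add_sub_add_comm]
  exact hA.add hB

theorem isCompactOperator_algebraMap_sub_toeplitz (c : ℂ) :
    IsCompactOperator (algebraMap ℂ (HardySpace →L[ℂ] HardySpace) c -
      toeplitz (algebraMap ℂ C(Circle, ℂ) c)) := by
  rw [Algebra.algebraMap_eq_smul_one, Algebra.algebraMap_eq_smul_one, toeplitz_smul, toeplitz_one,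
    sub_self]
  exact isCompactOperator_zero

/-- The closed algebra of the compact perturbations of Toeplitz operators. -/
def toeplitzPlusCompact : Subalgebra ℂ (HardySpace →L[ℂ] HardySpace) where
  carrier := {A | ∃ φ, IsCompactOperator (A - toeplitz φ)}
  mul_mem' := by
    rintro A B ⟨φ, hφ⟩ ⟨ψ, hψ⟩
    exact ⟨φ * ψ, isCompactOperator_mul_sub_toeplitz hφ hψ⟩
  add_mem' := by
    rintro A B ⟨φ, hφ⟩ ⟨ψ, hψ⟩
    exact ⟨φ + ψ, isCompactOperator_add_sub_toeplitz hφ hψ⟩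
  algebraMap_mem' c := ⟨_, isCompactOperator_algebraMap_sub_toeplitz c⟩

/-- Contractivity of the symbol makes the symbols of a convergent sequence Cauchy; subtracting the
Toeplitz operators leaves a convergent sequence of compact operators. -/
theorem isClosed_toeplitzPlusCompact :
    IsClosed (toeplitzPlusCompact : Set (HardySpace →L[ℂ] HardySpace)) := by
  refine isClosed_of_closure_subset fun A hA => ?_
  obtain ⟨a, ha, haA⟩ := mem_closure_iff_seq_limit.1 hA
  choose φ hφ using ha
  have hc : CauchySeq φ := by
    have := Metric.cauchySeq_iff.1 haA.cauchySeq
    refine Metric.cauchySeq_iff.2 fun ε hε => ?_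
    obtain ⟨N, hN⟩ := this ε hε
    refine ⟨N, fun m hm n hn => lt_of_le_of_lt ?_ (hN m hm n hn)⟩
    rw [dist_eq_norm, dist_eq_norm]
    exact norm_sub_le_of_isCompactOperator (hφ m) (hφ n)
  obtain ⟨ψ, hψ⟩ := cauchySeq_tendsto_of_complete hc
  exact ⟨ψ, isCompactOperator_of_tendsto
    (haA.sub ((toeplitzCLM.continuous.tendsto ψ).comp hψ)) (Eventually.of_forall hφ)⟩

theorem exists_isCompactOperator_sub_toeplitz (a : toeplitzAlgebra) :
    ∃ φ, IsCompactOperator ((a : HardySpace →L[ℂ] HardySpace) - toeplitz φ) := by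
  have hle : (StarAlgebra.adjoin ℂ (Set.range toeplitz)).toSubalgebra ≤ toeplitzPlusCompact := by
    rw [StarAlgebra.adjoin_toSubalgebra]
    refine Algebra.adjoin_le (Set.union_subset ?_ ?_)
    · rintro _ ⟨φ, rfl⟩
      exact ⟨φ, by rw [sub_self]; exact isCompactOperator_zero⟩
    · rintro A ⟨φ, hφ⟩
      refine ⟨star φ, ?_⟩
      rw [toeplitz_star, hφ, star_star, sub_self]
      exact isCompactOperator_zero
  exact closure_minimal hle isClosed_toeplitzPlusCompact a.2

/-- The Toeplitz operator `T_φ` as an element of the Toeplitz algebra, depending linearly and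
continuously on `φ`. -/
def toeplitzSection : C(Circle, ℂ) →L[ℂ] toeplitzAlgebra :=
  toeplitzCLM.codRestrict (Subalgebra.toSubmodule toeplitzAlgebra.toSubalgebra) fun φ =>
    StarSubalgebra.le_topologicalClosure _ (StarAlgebra.subset_adjoin ℂ _ ⟨φ, rfl⟩)

theorem coe_toeplitzSection (φ : C(Circle, ℂ)) :
    (toeplitzSection φ : HardySpace →L[ℂ] HardySpace) = toeplitz φ := rfl

/-- The symbol of an element of the Toeplitz algebra. -/
def symbolFun (a : toeplitzAlgebra) : C(Circle, ℂ) :=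
  (exists_isCompactOperator_sub_toeplitz a).choose

theorem isCompactOperator_sub_toeplitz_symbolFun (a : toeplitzAlgebra) :
    IsCompactOperator ((a : HardySpace →L[ℂ] HardySpace) - toeplitz (symbolFun a)) :=
  (exists_isCompactOperator_sub_toeplitz a).choose_spec

theorem symbolFun_eq {a : toeplitzAlgebra} {φ : C(Circle, ℂ)}
    (h : IsCompactOperator ((a : HardySpace →L[ℂ] HardySpace) - toeplitz φ)) : symbolFun a = φ :=
  eq_of_isCompactOperator_sub_toeplitz (isCompactOperator_sub_toeplitz_symbolFun a) h

/-- The symbol map `T_φ + k ↦ φ` as a homomorphism of algebras. -/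
def symbol : toeplitzAlgebra →ₐ[ℂ] C(Circle, ℂ) where
  toFun := symbolFun
  map_one' := symbolFun_eq (by simpa using isCompactOperator_algebraMap_sub_toeplitz 1)
  map_zero' := symbolFun_eq (by simpa using isCompactOperator_algebraMap_sub_toeplitz 0)
  map_mul' a b := symbolFun_eq (isCompactOperator_mul_sub_toeplitz
    (isCompactOperator_sub_toeplitz_symbolFun a) (isCompactOperator_sub_toeplitz_symbolFun b))
  map_add' a b := symbolFun_eq (isCompactOperator_add_sub_toeplitz
    (isCompactOperator_sub_toeplitz_symbolFun a) (isCompactOperator_sub_toeplitz_symbolFun b))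
  commutes' c := symbolFun_eq (isCompactOperator_algebraMap_sub_toeplitz c)

theorem isCompactOperator_sub_toeplitz_symbol (a : toeplitzAlgebra) :
    IsCompactOperator ((a : HardySpace →L[ℂ] HardySpace) - toeplitz (symbol a)) :=
  isCompactOperator_sub_toeplitz_symbolFun a

theorem symbol_toeplitzSection (φ : C(Circle, ℂ)) : symbol (toeplitzSection φ) = φ :=
  symbolFun_eq (by rw [coe_toeplitzSection, sub_self]; exact isCompactOperator_zero)

theorem symbol_eq_zero_iff {a : toeplitzAlgebra} : symbol a = 0 ↔ a ∈ compactIdeal := by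
  have h0 : toeplitz 0 = 0 := toeplitzCLM.map_zero
  constructor
  · intro h
    have := isCompactOperator_sub_toeplitz_symbol a
    rwa [h, h0, sub_zero] at this
  · intro h
    exact symbolFun_eq (by rw [h0, sub_zero]; exact h)

theorem norm_symbol_le (a : toeplitzAlgebra) : ‖symbol a‖ ≤ ‖a‖ := by
  have := norm_sub_le_of_isCompactOperator (isCompactOperator_sub_toeplitz_symbol a)
    (isCompactOperator_sub_toeplitz_symbol 0)
  simpa using this

theorem continuous_symbol : Continuous symbol :=
  AddMonoidHomClass.continuous_of_bound symbol 1 fun a => by simpa using norm_symbol_le a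

/-! ### Winding numbers and symbols of invertible elements -/

/-- The increment of a logarithm over a period is a continuous integer multiple of `2πi`, hence
constant, hence zero; the logarithm therefore descends to the circle. -/
theorem exists_exp_eq_of_windingNumber_eq_zero {φ : C(Circle, ℂ)ˣ} (hφ : windingNumber φ = 0) :
    ∃ ψ : C(Circle, ℂ), ∀ z, Complex.exp (ψ z) = (φ : C(Circle, ℂ)) z := by
  obtain ⟨ψ, hψ⟩ := exists_isLogLift φ
  have hw := hψ.windingNumber_eq
  rw [hφ, Int.cast_zero, zero_mul] at hw
  have key : ∀ t, ∃ n : ℤ, ψ (t + 2 * Real.pi) - ψ t = n * (2 * Real.pi * Complex.I) := fun t => by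
    have : Complex.exp (ψ (t + 2 * Real.pi)) = Complex.exp (ψ t) := by
      rw [hψ, hψ, Circle.periodic_exp]
    obtain ⟨n, hn⟩ := Complex.exp_eq_exp_iff_exists_int.1 this
    exact ⟨n, by rw [hn]; ring⟩
  choose N hN using key
  have hc : Continuous fun t => ((N t : ℤ) : ℂ) := by
    have : (fun t => ((N t : ℤ) : ℂ)) =
        fun t => (ψ (t + 2 * Real.pi) - ψ t) / (2 * Real.pi * Complex.I) := by
      funext t
      rw [hN, mul_div_cancel_right₀ _ Complex.two_pi_I_ne_zero]
    rw [this]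
    fun_prop
  have hN' : Continuous N := Complex.isClosedEmbedding_intCast.isInducing.continuous_iff.2 hc
  have hper : Function.Periodic ψ (2 * Real.pi) := fun t => by
    have h0 := hN 0
    rw [zero_add, hw] at h0
    have ht := hN t
    rw [PreconnectedSpace.constant inferInstance hN' (y := 0), ← h0] at ht
    exact sub_eq_zero.1 ht
  have hq : Topology.IsQuotientMap Circle.exp :=
    isLocalHomeomorph_circleExp.isOpenMap.isQuotientMap Circle.exp.continuous Circle.exp_surjective
  have hfac : Function.FactorsThrough ψ Circle.exp := fun s t hst => by
    obtain ⟨m, hm⟩ := Circle.exp_eq_exp.1 hst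
    rw [hm]
    exact hper.int_mul m t
  refine ⟨hq.lift ψ hfac, fun z => ?_⟩
  obtain ⟨t, rfl⟩ := Circle.exp_surjective z
  rw [← hψ t]
  exact congrArg Complex.exp (congrArg (fun f : C(ℝ, ℂ) => f t) (hq.lift_comp ψ hfac))

theorem exists_symbol_eq_of_windingNumber_eq_zero {φ : C(Circle, ℂ)ˣ}
    (hφ : windingNumber φ = 0) : ∃ g : toeplitzAlgebraˣ, Units.map (symbol : _ →* _) g = φ := by
  obtain ⟨ψ, hψ⟩ := exists_exp_eq_of_windingNumber_eq_zero hφ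
  let : NormedAlgebra ℚ toeplitzAlgebra := .restrictScalars ℚ ℂ _
  let : NormedAlgebra ℚ C(Circle, ℂ) := .restrictScalars ℚ ℂ _
  refine ⟨(NormedSpace.isUnit_exp (toeplitzSection ψ)).unit, Units.ext ?_⟩
  have h := NormedSpace.map_exp symbol continuous_symbol (toeplitzSection ψ)
  rw [symbol_toeplitzSection] at h
  refine h.trans (ContinuousMap.ext fun z => ?_)
  rw [← hψ z, Complex.exp_eq_exp_ℂ]
  exact NormedSpace.map_exp (ContinuousMap.evalAlgHom ℂ ℂ z)
    (continuous_eval_const z) ψ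

/-- The unit `χₙ` of `C(𝕋)`. -/
def monomialUnit (n : ℤ) : C(Circle, ℂ)ˣ where
  val := monomial n
  inv := monomial (-n)
  val_inv := by rw [← monomial_add, add_neg_cancel, monomial_zero]
  inv_val := by rw [← monomial_add, neg_add_cancel, monomial_zero]

theorem windingNumber_monomialUnit (n : ℤ) : windingNumber (monomialUnit n) = n := by
  let ψ : C(ℝ, ℂ) := ⟨fun t => n * (t * Complex.I), by fun_prop⟩
  have h : IsLogLift (monomialUnit n) ψ := fun t => by
    simp [ψ, monomialUnit, monomial_apply, Complex.exp_int_mul]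
  have e := h.windingNumber_eq
  have : (windingNumber (monomialUnit n) : ℂ) = n := by
    apply mul_right_cancel₀ Complex.two_pi_I_ne_zero
    rw [← e]
    simp [ψ]
  exact_mod_cast this

theorem hardyMonomial_zero_ne_zero : hardyMonomial 0 ≠ 0 := by
  intro h
  have h1 := inner_toLp (monomial 0) (monomial 0)
  have h2 : ContinuousMap.toLp 2 circleMeasure ℂ (monomial ((0 : ℕ) : ℤ)) = 0 :=
    congrArg hardyInclusion h
  rw [Nat.cast_zero] at h2
  rw [h2, inner_zero_left] at h1
  simp [monomial_zero] at h1

/-- An invertible element of the Toeplitz algebra with symbol `z⁻ᵐ`, `m ≥ 0`, exists only for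
`m = 0`. -/
theorem eq_zero_of_symbol_eq_monomial_neg {g : toeplitzAlgebraˣ} {m : ℕ}
    (h : symbol g = monomial (-m)) : m = 0 := by
  let A : HardySpace →L[ℂ] HardySpace := (g : toeplitzAlgebra)
  let B : HardySpace →L[ℂ] HardySpace := ((g⁻¹ : toeplitzAlgebraˣ) : toeplitzAlgebra)
  have hBA : B * A = 1 := congrArg Subtype.val g.inv_mul
  have hA : Function.Injective A := fun x y hxy => by
    have := congrArg B hxy
    rwa [← mul_apply_eq_comp, ← mul_apply_eq_comp, hBA] at this
  have hS : toeplitz (monomial (-m)) * toeplitz (monomial m) = 1 := by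
    rw [← toeplitz_mul_monomial, ← monomial_add, neg_add_cancel, monomial_zero, toeplitz_one]
  have hSinj : Function.Injective (toeplitz (monomial m)) := fun x y hxy => by
    have := congrArg (toeplitz (monomial (-m))) hxy
    rwa [← mul_apply_eq_comp, ← mul_apply_eq_comp, hS] at this
  have hc : IsCompactOperator
      (A * toeplitz (monomial m) - 1 : HardySpace →L[ℂ] HardySpace) := by
    have := (isCompactOperator_sub_toeplitz_symbol g).comp_clm (toeplitz (monomial m))
    rw [h] at this
    rw [← hS, ← sub_mul]
    exact this
  by_contra hm
  -- Fredholm alternative for `A S = 1 + compact`, with `S` the `m`-th power of the shift. An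
  -- eigenvector for `-1` would lie in the kernel of the injective operator `A S`. Otherwise `A S`
  -- is onto, which puts `χ₀` in the range of `S`, although the left inverse of `S` kills `χ₀` when
  -- `m > 0`.
  rcases hc.hasEigenvalue_or_mem_resolventSet (μ := (-1 : ℂ)) (by norm_num) with hev | hres
  · obtain ⟨v, hv⟩ := hev.exists_hasEigenvector
    have hv1 := hv.apply_eq_smul
    have hv2 : A (toeplitz (monomial m) v) = 0 := by
      simpa [sub_eq_iff_eq_add] using hv1
    exact hv.2 (hSinj (hA (by rw [hv2, map_zero, map_zero])))
  · rw [spectrum.mem_resolventSet_iff, ← IsUnit.neg_iff,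
      ContinuousLinearMap.isUnit_iff_bijective] at hres
    have e : -(algebraMap ℂ (HardySpace →L[ℂ] HardySpace) (-1) -
        (A * toeplitz (monomial m) - 1)) = A * toeplitz (monomial m) := by
      rw [map_neg, map_one]; abel
    rw [e] at hres
    obtain ⟨f, hf⟩ := hres.surjective (A (hardyMonomial 0))
    have hf' : toeplitz (monomial m) f = hardyMonomial 0 := hA hf
    have hf0 : f = 0 := by
      have := congrArg (toeplitz (monomial (-m))) hf'
      rwa [← mul_apply_eq_comp, hS, toeplitz_monomial_neg_hardyMonomial (Nat.pos_of_ne_zero hm)]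
        at this
    exact hardyMonomial_zero_ne_zero (by rw [← hf', hf0, map_zero])

/-- Passing to `g⁻¹` reduces positive exponents to negative ones. -/
theorem eq_zero_of_symbol_eq_monomialUnit {g : toeplitzAlgebraˣ} {n : ℤ}
    (h : Units.map (symbol : _ →* _) g = monomialUnit n) : n = 0 := by
  have h1 : symbol g = monomial n := congrArg Units.val h
  have h2 : symbol (g⁻¹ : toeplitzAlgebraˣ) = monomial (-n) :=
    congrArg (fun u : C(Circle, ℂ)ˣ => ((u⁻¹ : C(Circle, ℂ)ˣ) : C(Circle, ℂ))) h
  obtain ⟨m, rfl | rfl⟩ := n.eq_nat_or_neg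
  · simpa using eq_zero_of_symbol_eq_monomial_neg h2
  · simpa using eq_zero_of_symbol_eq_monomial_neg h1

/-- The symbol of an invertible element of the Toeplitz algebra has winding number zero. -/
theorem windingNumber_symbol (g : toeplitzAlgebraˣ) :
    windingNumber (Units.map (symbol : _ →* _) g) = 0 := by
  set φ := Units.map (symbol : toeplitzAlgebra →* C(Circle, ℂ)) g with hφ
  -- Correcting `φ` by a monomial makes it liftable; comparing the lift with `g` produces an
  -- invertible element whose symbol is that monomial.
  have hw : windingNumber (φ * monomialUnit (-windingNumber φ)) = 0 := by
    rw [windingNumber_mul, windingNumber_monomialUnit, add_neg_cancel]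
  obtain ⟨g', hg'⟩ := exists_symbol_eq_of_windingNumber_eq_zero hw
  have : Units.map (symbol : toeplitzAlgebra →* C(Circle, ℂ)) (g⁻¹ * g') =
      monomialUnit (-windingNumber φ) := by
    rw [map_mul, hg', map_inv, ← hφ, inv_mul_cancel_left]
  simpa using eq_zero_of_symbol_eq_monomialUnit this

/-- The symbol map as a homomorphism from the invertible elements of the Toeplitz algebra to the
functions of winding number zero. -/
def unitsSymbol : toeplitzAlgebraˣ →* windingZero :=
  (Units.map (symbol : toeplitzAlgebra →* C(Circle, ℂ))).codRestrict windingZero windingNumber_symbol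

theorem coe_unitsSymbol (g : toeplitzAlgebraˣ) :
    ((unitsSymbol g : C(Circle, ℂ)ˣ) : C(Circle, ℂ)) = symbol g := rfl

theorem unitsSymbol_surjective : Function.Surjective unitsSymbol := fun φ => by
  obtain ⟨g, hg⟩ := exists_symbol_eq_of_windingNumber_eq_zero φ.2
  exact ⟨g, Subtype.ext hg⟩

theorem ker_unitsSymbol : unitsSymbol.ker = onePlusCompact := by
  ext g
  change unitsSymbol g = 1 ↔ (g : toeplitzAlgebra) - 1 ∈ compactIdeal
  rw [← symbol_eq_zero_iff, map_sub, map_one, sub_eq_zero, Subtype.ext_iff, Units.ext_iff,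
    coe_unitsSymbol]
  rfl

/-! ### Two facts on maps between Banach manifolds -/

section Manifold

variable {E F M N : Type*} [NormedAddCommGroup E] [NormedSpace ℝ E]
  [NormedAddCommGroup F] [NormedSpace ℝ F] [TopologicalSpace M] [ChartedSpace E M]
  [TopologicalSpace N] [ChartedSpace F N]

/-- The inverse function theorem for a homeomorphism between Banach manifolds. -/
theorem Homeomorph.contMDiffAt_symm_of_bijective_mfderiv [CompleteSpace E] [CompleteSpace F]
    {n : ℕ∞ω} (hn : n ≠ 0) (Ψ : M ≃ₜ N) {x : M}
    (hΨ : ContMDiffAt 𝓘(ℝ, E) 𝓘(ℝ, F) n Ψ x)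
    (hbij : Function.Bijective (mfderiv 𝓘(ℝ, E) 𝓘(ℝ, F) Ψ x)) :
    ContMDiffAt 𝓘(ℝ, F) 𝓘(ℝ, E) n Ψ.symm (Ψ x) := by
  -- This is `Ψ` read in charts, already known to be invertible, so only the smoothness of its
  -- inverse is at stake.
  let f : OpenPartialHomeomorph E F :=
    (chartAt E x).symm.trans (Ψ.toOpenPartialHomeomorph.trans (chartAt F (Ψ x)))
  have hd := (hΨ.mdifferentiableAt hn).hasMFDerivAt.2
  have hs := (contMDiffAt_iff.1 hΨ).2
  simp only [modelWithCornersSelf_coe, Set.range_id, contDiffWithinAt_univ] at hd hs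
  have hx : f.symm (chartAt F (Ψ x) (Ψ x)) = chartAt E x x := by
    simp [f]
  have hmem : chartAt F (Ψ x) (Ψ x) ∈ f.target := by
    simp [f]
  let D : E →L[ℝ] F := mfderiv 𝓘(ℝ, E) 𝓘(ℝ, F) Ψ x
  let e : E ≃L[ℝ] F := ContinuousLinearEquiv.ofBijective D
    (LinearMap.ker_eq_bot.2 hbij.injective) (LinearMap.range_eq_top.2 hbij.surjective)
  have he : (e : E →L[ℝ] F) = D := by ext v; rfl
  have key : ContDiffAt ℝ n f.symm (chartAt F (Ψ x) (Ψ x)) := by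
    refine f.contDiffAt_symm (f₀' := e) hmem ?_ ?_
    · rw [hx, he]
      have hd' : HasFDerivWithinAt f D _root_.Set.univ (chartAt E x x) := hd
      exact hasFDerivWithinAt_univ.1 hd'
    · rw [hx]
      exact hs
  refine contMDiffAt_iff.2 ⟨Ψ.symm.continuous.continuousAt, ?_⟩
  simp only [modelWithCornersSelf_coe, Set.range_id, contDiffWithinAt_univ,
    Homeomorph.symm_apply_apply]
  exact key

/-- A curve in a Banach manifold with vanishing derivative is constant. -/
theorem eq_of_hasMFDerivAt_eq_zero [IsManifold 𝓘(ℝ, E) 1 M] {γ : ℝ → M}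
    (hγ : ∀ t, HasMFDerivAt 𝓘(ℝ, ℝ) 𝓘(ℝ, E) γ t 0) (s t : ℝ) : γ s = γ t := by
  refine IsLocallyConstant.apply_eq_of_isPreconnected (s := Set.univ) ?_ isPreconnected_univ
    trivial trivial
  refine (IsLocallyConstant.iff_eventually_eq γ).2 fun a => ?_
  have hsrc : ∀ᶠ b in 𝓝 a, γ b ∈ (chartAt E (γ a)).source :=
    (hγ a).continuousAt.eventually ((chartAt E (γ a)).open_source.mem_nhds (mem_chart_source E _))
  obtain ⟨ε, hε, hball⟩ := Metric.eventually_nhds_iff_ball.1 hsrc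
  have hder : ∀ b ∈ Metric.ball a ε, HasFDerivAt (extChartAt 𝓘(ℝ, E) (γ a) ∘ γ) (0 : ℝ →L[ℝ] E) b :=
    fun b hb => by
      have h1 := (mdifferentiableAt_extChartAt (I := 𝓘(ℝ, E)) (hball b hb)).hasMFDerivAt
      have h2 := h1.comp b (hγ b)
      rw [ContinuousLinearMap.comp_zero] at h2
      exact h2.hasFDerivAt
  filter_upwards [Metric.ball_mem_nhds a hε] with b hb
  have h := (convex_ball a ε).is_const_of_fderivWithin_eq_zero (𝕜 := ℝ)
    (f := extChartAt 𝓘(ℝ, E) (γ a) ∘ γ)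
    (fun c hc => (hder c hc).differentiableAt.differentiableWithinAt)
    (fun c hc => ((hder c hc).hasFDerivWithinAt).fderivWithin
      (Metric.isOpen_ball.uniqueDiffWithinAt hc)) hb (Metric.mem_ball_self hε)
  refine (extChartAt 𝓘(ℝ, E) (γ a)).injOn ?_ ?_ h
  · rw [extChartAt_source]; exact hball b hb
  · exact mem_extChartAt_source (γ a)

end Manifold

/-! ### Quotients of unit groups by the kernel of a split homomorphism of Banach algebras -/

section Quotient

/-- Every point `a` lies on the continuous affine section `b ↦ a + τ (b - σ a)`. -/
theorem AlgHom.isOpenMap_of_rightInverse {A B : Type*} [NormedRing A] [NormedAlgebra ℝ A]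
    [NormedRing B] [NormedAlgebra ℝ B] {σ : A →ₐ[ℝ] B} {τ : B →L[ℝ] A} (hτ : ∀ b, σ (τ b) = b) : IsOpenMap σ := by
  refine IsOpenMap.of_sections fun a => ⟨fun b => a + τ (b - σ a), ?_, ?_, fun b => ?_⟩
  · fun_prop
  · simp
  · simp [hτ]

variable {A B : Type*} [NormedRing A] [NormedAlgebra ℝ A] [CompleteSpace A]
  [NormedRing B] [NormedAlgebra ℝ B]
  {W : Subgroup Bˣ} {σ : A →ₐ[ℝ] B} {τ : B →L[ℝ] A} {q : Aˣ →* W} {K : Subgroup Aˣ} [K.Normal]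

theorem exists_quotient_continuousMulEquiv (hW : IsOpenEmbedding fun w : W => ((w : Bˣ) : B))
    (hσ : Continuous σ) (hτ : ∀ b, σ (τ b) = b) (hq : ∀ g, ((q g : Bˣ) : B) = σ g)
    (hqs : Function.Surjective q) (hK : q.ker = K) :
    ∃ Φ : Aˣ ⧸ K ≃ₜ* W, ∀ g : Aˣ, Φ g = q g := by
  subst hK
  let Φ := QuotientGroup.quotientKerEquivOfSurjective q hqs
  have hΦ : ∀ g : Aˣ, Φ g = q g := fun g => rfl
  have hcomp : (fun w : W => ((w : Bˣ) : B)) ∘ q = σ ∘ Units.val := funext hq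
  have hqc : Continuous q := by
    rw [hW.isInducing.continuous_iff, hcomp]
    exact hσ.comp Units.continuous_val
  have hqo : IsOpenMap q := by
    rw [hW.isOpenMap_iff, hcomp]
    exact (AlgHom.isOpenMap_of_rightInverse hτ).comp Units.isOpenEmbedding_val.isOpenMap
  have hc : Continuous Φ := continuous_quot_lift _ hqc
  have ho : IsOpenMap Φ := fun U hU => by
    have e : Φ '' U = q '' (QuotientGroup.mk ⁻¹' U) := by
      rw [← Set.image_preimage_eq U QuotientGroup.mk_surjective, Set.image_image,
        Set.image_preimage_eq U QuotientGroup.mk_surjective]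
      rfl
    rw [e]
    exact hqo _ (hU.preimage QuotientGroup.continuous_mk)
  refine ⟨{ Φ with continuous_toFun := hc, continuous_invFun := ?_ }, hΦ⟩
  exact (Φ.toEquiv.toHomeomorphOfContinuousOpen hc ho).symm.continuous

theorem contMDiff_of_val_eq (hW : IsOpenEmbedding fun w : W => ((w : Bˣ) : B))
    (hσ : Continuous σ) (hq : ∀ g, ((q g : Bˣ) : B) = σ g) :
    letI := hW.singletonChartedSpace
    ContMDiff 𝓘(ℝ, A) 𝓘(ℝ, B) ∞ q := by
  let := hW.singletonChartedSpace
  refine ContMDiff.of_comp_isOpenEmbedding hW ?_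
  have : (fun w : W => ((w : Bˣ) : B)) ∘ q = σ ∘ Units.val := funext hq
  rw [this]
  let σ' : A →L[ℝ] B := ⟨σ.toLinearMap, hσ⟩
  exact σ'.contMDiff.comp Units.contMDiff_val

/-- A homomorphism of unit groups that is induced by a split homomorphism of Banach algebras has
smooth local sections. -/
theorem exists_local_section (hW : IsOpenEmbedding fun w : W => ((w : Bˣ) : B))
    (hτ : ∀ b, σ (τ b) = b) (hq : ∀ g, ((q g : Bˣ) : B) = σ g) (g : Aˣ) :
    letI := hW.singletonChartedSpace
    ∃ s : W → Aˣ, ContMDiffAt 𝓘(ℝ, B) 𝓘(ℝ, A) ∞ s (q g) ∧ s (q g) = g ∧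
      ∀ᶠ w in 𝓝 (q g), q (s w) = w := by
  let := hW.singletonChartedSpace
  let e : OpenPartialHomeomorph Aˣ A := Units.isOpenEmbedding_val.toOpenPartialHomeomorph
  -- The affine section of `σ` through `g`; near `q g` its values are units because units form an
  -- open set.
  let r : W → A := fun w => g + τ (((w : Bˣ) : B) - ((q g : Bˣ) : B))
  have hr : ContMDiff 𝓘(ℝ, B) 𝓘(ℝ, A) ∞ r := by
    have h1 : ContMDiff 𝓘(ℝ, B) 𝓘(ℝ, B) ∞ (fun w : W => ((w : Bˣ) : B)) :=
      contMDiff_isOpenEmbedding hW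
    have h2 : ContDiff ℝ ∞ fun b : B => (g : A) + τ (b - ((q g : Bˣ) : B)) := by fun_prop
    exact h2.contMDiff.comp h1
  have hrg : r (q g) = g := by simp [r]
  have htgt : r (q g) ∈ Set.range (Units.val : Aˣ → A) := ⟨g, hrg.symm⟩
  have hnhds : Set.range (Units.val : Aˣ → A) ∈ 𝓝 (r (q g)) :=
    Units.isOpenEmbedding_val.isOpen_range.mem_nhds htgt
  have hval : ∀ a ∈ Set.range (Units.val : Aˣ → A), ((e.symm a : Aˣ) : A) = a := fun a ha =>
    e.right_inv (by simpa [e] using ha)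
  refine ⟨e.symm ∘ r, ?_, ?_, ?_⟩
  · refine ContMDiffAt.comp _ ?_ hr.contMDiffAt
    exact (contMDiffOn_isOpenEmbedding_symm Units.isOpenEmbedding_val).contMDiffAt hnhds
  · exact Units.ext ((hval _ htgt).trans hrg)
  · filter_upwards [hr.continuous.continuousAt.eventually hnhds] with w hw
    apply hW.injective
    change ((q (e.symm (r w)) : Bˣ) : B) = _
    rw [hq, hval _ hw, map_add, hτ, hq, add_sub_cancel]

theorem exists_isHomogeneousLieGroup [CompleteSpace B] (hW : IsOpenEmbedding fun w : W => ((w : Bˣ) : B))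
    (hσ : Continuous σ) (hτ : ∀ b, σ (τ b) = b) (hq : ∀ g, ((q g : Bˣ) : B) = σ g)
    (Φ : Aˣ ⧸ K ≃ₜ* W) (hΦ : ∀ g : Aˣ, Φ g = q g) :
    ∃ cs : ChartedSpace B (Aˣ ⧸ K), IsHomogeneousLieGroup (E := A) K cs := by
  have hf : IsOpenEmbedding fun x : Aˣ ⧸ K => ((Φ x : Bˣ) : B) :=
    hW.comp Φ.toHomeomorph.isOpenEmbedding
  let csW := hW.singletonChartedSpace
  let cs := hf.singletonChartedSpace
  have hval : ContMDiff 𝓘(ℝ, B) 𝓘(ℝ, B) ∞ (fun x : Aˣ ⧸ K => ((Φ x : Bˣ) : B)) :=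
    contMDiff_isOpenEmbedding hf
  have hunit : ContMDiff 𝓘(ℝ, B) 𝓘(ℝ, B) ∞ (fun x : Aˣ ⧸ K => (Φ x : Bˣ)) :=
    ContMDiff.of_comp_isOpenEmbedding Units.isOpenEmbedding_val hval
  have hΦs : ContMDiff 𝓘(ℝ, B) 𝓘(ℝ, B) ∞ Φ := ContMDiff.of_comp_isOpenEmbedding hW hval
  have hman : IsManifold 𝓘(ℝ, B) ∞ (Aˣ ⧸ K) := hf.isManifold_singleton
  have hmk : ContMDiff 𝓘(ℝ, A) 𝓘(ℝ, B) ∞ (QuotientGroup.mk : Aˣ → Aˣ ⧸ K) := by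
    refine ContMDiff.of_comp_isOpenEmbedding hf ?_
    have : (fun x : Aˣ ⧸ K => ((Φ x : Bˣ) : B)) ∘ (QuotientGroup.mk : Aˣ → Aˣ ⧸ K) =
        (fun w : W => ((w : Bˣ) : B)) ∘ q := funext fun g => by simp [hΦ]
    rw [this]
    exact (contMDiff_isOpenEmbedding hW).comp (contMDiff_of_val_eq hW hσ hq)
  refine ⟨cs, hf.isEmbedding.t2Space, ?_, hmk, fun g v => ?_⟩
  · exact
      { contMDiff_mul := by
          apply ContMDiff.of_comp_isOpenEmbedding hf
          have : (fun x : Aˣ ⧸ K => ((Φ x : Bˣ) : B)) ∘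
              (fun p : (Aˣ ⧸ K) × (Aˣ ⧸ K) => p.1 * p.2) =
              fun p => (((Φ p.1 : Bˣ) * (Φ p.2 : Bˣ) : Bˣ) : B) := by
            funext p; simp
          rw [this]
          exact Units.contMDiff_val.comp
            ((hunit.comp contMDiff_fst).mul (hunit.comp contMDiff_snd))
        contMDiff_inv := by
          apply ContMDiff.of_comp_isOpenEmbedding hf
          have : (fun x : Aˣ ⧸ K => ((Φ x : Bˣ) : B)) ∘ (fun x => x⁻¹) =
              fun x => (((Φ x : Bˣ)⁻¹ : Bˣ) : B) := by
            funext x; simp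
          rw [this]
          exact Units.contMDiff_val.comp hunit.inv }
  -- A smooth local section of the quotient map through `g` yields a right inverse of its
  -- differential.
  · obtain ⟨s, hs, hsg, hsq⟩ := exists_local_section hW hτ hq g
    have hs' : ContMDiffAt 𝓘(ℝ, B) 𝓘(ℝ, A) ∞ (s ∘ Φ) (g : Aˣ ⧸ K) :=
      ContMDiffAt.comp _ (by rwa [hΦ]) hΦs.contMDiffAt
    have hpt : (s ∘ Φ) (g : Aˣ ⧸ K) = g := by rw [Function.comp_apply, hΦ, hsg]
    have hd1 := (hs'.mdifferentiableAt (by simp)).hasMFDerivAt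
    have hd2 : HasMFDerivAt 𝓘(ℝ, A) 𝓘(ℝ, B) (QuotientGroup.mk : Aˣ → Aˣ ⧸ K)
        ((s ∘ Φ) (g : Aˣ ⧸ K)) (mfderiv 𝓘(ℝ, A) 𝓘(ℝ, B) (QuotientGroup.mk : Aˣ → Aˣ ⧸ K) g) := by
      rw [hpt]
      exact (hmk.mdifferentiable (by simp) g).hasMFDerivAt
    have hd := hd2.comp _ hd1
    have hev : ((QuotientGroup.mk : Aˣ → Aˣ ⧸ K) ∘ (s ∘ Φ)) =ᶠ[𝓝 (g : Aˣ ⧸ K)] id := by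
      have hcont : Tendsto Φ (𝓝 (g : Aˣ ⧸ K)) (𝓝 (Φ g)) := Φ.continuous.tendsto _
      rw [hΦ] at hcont
      filter_upwards [hcont.eventually hsq] with x hx
      apply Φ.injective
      rw [Function.comp_apply, hΦ]
      exact hx
    have hid := hasMFDerivAt_unique (hd.congr_of_eventuallyEq hev.symm) (hasMFDerivAt_id _)
    exact ⟨_, congrArg (fun L : B →L[ℝ] B => L v) hid⟩

/-- Locally the inverse is the quotient map after a smooth section of `q`, so it is smooth for every
admissible structure on the quotient. -/
theorem contMDiff_quotient_equiv_symm (hW : IsOpenEmbedding fun w : W => ((w : Bˣ) : B))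
    (hτ : ∀ b, σ (τ b) = b) (hq : ∀ g, ((q g : Bˣ) : B) = σ g)
    (hqs : Function.Surjective q)
    (Φ : Aˣ ⧸ K ≃ₜ* W) (hΦ : ∀ g : Aˣ, Φ g = q g) [cs : ChartedSpace B (Aˣ ⧸ K)]
    (h : IsHomogeneousLieGroup (E := A) K cs) :
    letI := hW.singletonChartedSpace
    ContMDiff 𝓘(ℝ, B) 𝓘(ℝ, B) ∞ Φ.symm := by
  let := hW.singletonChartedSpace
  intro w
  obtain ⟨g, rfl⟩ := hqs w
  obtain ⟨s, hs, -, hsq⟩ := exists_local_section hW hτ hq g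
  refine (h.contMDiff_mk.contMDiffAt.comp _ hs).congr_of_eventuallyEq ?_
  filter_upwards [hsq] with w hw
  apply Φ.injective
  rw [Function.comp_apply, hΦ, hw]
  exact Φ.apply_symm_apply w

/-- A vector `v` killed by the differential is the velocity of a translated one-parameter group in
`W`. Its image in the quotient has zero velocity at `0`, hence everywhere by translation, so it is
constant. As `Φ.symm` is injective, the curve in `W` is constant too, and `v = 0`. -/
theorem injective_mfderiv_quotient_equiv_symm
    (hW : IsOpenEmbedding fun w : W => ((w : Bˣ) : B))
    (hσ : Continuous σ) (hτ : ∀ b, σ (τ b) = b) (hq : ∀ g, ((q g : Bˣ) : B) = σ g)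
    (hqs : Function.Surjective q)
    (Φ : Aˣ ⧸ K ≃ₜ* W) (hΦ : ∀ g : Aˣ, Φ g = q g) [cs : ChartedSpace B (Aˣ ⧸ K)]
    (h : IsHomogeneousLieGroup (E := A) K cs) (w : W) :
    letI := hW.singletonChartedSpace
    Function.Injective (mfderiv 𝓘(ℝ, B) 𝓘(ℝ, B) Φ.symm w) := by
  let := hW.singletonChartedSpace
  have := h.lieGroup
  have : IsManifold 𝓘(ℝ, B) 1 (Aˣ ⧸ K) := IsManifold.of_le (n := ∞) (by simp)
  obtain ⟨g, rfl⟩ := hqs w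
  refine (injective_iff_map_eq_zero _).2 fun (v : B) hv => ?_
  -- Chosen so that `σ (g * exp (t • y))` has derivative `σ (g * y) = v` at `t = 0`.
  let y : A := (g⁻¹ : Aˣ) * τ v
  have hy : σ (g * y) = v := by rw [Units.mul_inv_cancel_left, hτ]
  let : NormedAlgebra ℚ A := .restrictScalars ℚ ℝ A
  let E : ℝ → Aˣ := fun t => (NormedSpace.isUnit_exp (t • y)).unit
  have hE : ∀ t, (E t : A) = NormedSpace.exp (t • y) := fun t => rfl
  have hE0 : E 0 = 1 := Units.ext (by rw [hE, zero_smul, NormedSpace.exp_zero, Units.val_one])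
  have hEadd : ∀ s t, E (s + t) = E s * E t := fun s t => Units.ext (by
    rw [Units.val_mul, hE, hE, hE, add_smul, NormedSpace.exp_add_of_commute
      (((Commute.refl y).smul_left s).smul_right t)])
  let path : ℝ → W := fun t => q (g * E t)
  have hpath0 : path 0 = q g := by simp only [path]; rw [hE0, mul_one]
  let σ' : A →L[ℝ] B := ⟨σ.toLinearMap, hσ⟩
  have hpathval : ∀ t, ((path t : Bˣ) : B) = σ' (g * NormedSpace.exp (t • y)) := fun t => hq _
  have hder : HasDerivAt (fun t => ((path t : Bˣ) : B)) v 0 := by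
    have h1 := (hasDerivAt_exp_smul_const (𝕂 := ℝ) y 0).const_mul (g : A)
    have h2 := σ'.hasFDerivAt.comp_hasDerivAt (0 : ℝ) h1
    rw [zero_smul, NormedSpace.exp_zero, one_mul] at h2
    have e : σ' ((g : A) * y) = v := hy
    rw [e] at h2
    exact h2.congr_of_eventuallyEq (Eventually.of_forall hpathval)
  have hpathcont : Continuous path := by
    rw [hW.isInducing.continuous_iff]
    refine Continuous.congr (f := fun t => σ' (g * NormedSpace.exp (t • y))) ?_
      fun t => (hpathval t).symm
    have := NormedSpace.exp_continuous (𝔸 := A)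
    fun_prop
  have hpath : HasMFDerivAt 𝓘(ℝ, ℝ) 𝓘(ℝ, B) path 0 (ContinuousLinearMap.toSpanSingleton ℝ v) := by
    refine ⟨hpathcont.continuousAt, ?_⟩
    exact hder.hasFDerivAt.hasFDerivWithinAt
  have hΦs := contMDiff_quotient_equiv_symm hW hτ hq hqs Φ hΦ h
  have hγ0 : HasMFDerivAt 𝓘(ℝ, ℝ) 𝓘(ℝ, B) (Φ.symm ∘ path) 0 0 := by
    have h1 : HasMFDerivAt 𝓘(ℝ, B) 𝓘(ℝ, B) Φ.symm (path 0)
        (mfderiv 𝓘(ℝ, B) 𝓘(ℝ, B) Φ.symm (q g)) := by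
      rw [hpath0]
      exact (hΦs.mdifferentiable (by simp) _).hasMFDerivAt
    have h2 := h1.comp 0 hpath
    convert h2 using 1
    ext
    let D : B →L[ℝ] B := mfderiv 𝓘(ℝ, B) 𝓘(ℝ, B) Φ.symm (q g)
    change (0 : B) = D ((1 : ℝ) • v)
    rw [one_smul]
    exact hv.symm
  have hγ : ∀ t, HasMFDerivAt 𝓘(ℝ, ℝ) 𝓘(ℝ, B) (Φ.symm ∘ path) t 0 := fun t => by
    -- Since `g E(s) = (g E(t) g⁻¹)(g E(s - t))`, left translation by `c` carries the curve near
    -- time `0` to the curve near time `t`.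
    let c : Aˣ ⧸ K := Φ.symm (q (g * E t * g⁻¹))
    have e : Φ.symm ∘ path = (fun x => c * x) ∘ (Φ.symm ∘ path) ∘ (fun s => s - t) := by
      funext s
      simp only [c, path, Function.comp_apply, ← map_mul]
      congr 2
      rw [mul_assoc _ g⁻¹, inv_mul_cancel_left, mul_assoc, ← hEadd, add_sub_cancel]
    have h1 : HasMFDerivAt 𝓘(ℝ, ℝ) 𝓘(ℝ, ℝ) (fun s : ℝ => s - t) t (ContinuousLinearMap.id ℝ ℝ) :=
      ((hasFDerivAt_id t).sub_const t).hasMFDerivAt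
    have h2 : HasMFDerivAt 𝓘(ℝ, ℝ) 𝓘(ℝ, B) (Φ.symm ∘ path) (t - t) 0 := by
      rw [sub_self]; exact hγ0
    have h3 := (((contMDiff_mul_left (I := 𝓘(ℝ, B)) (n := ∞) (a := c)).mdifferentiable (by simp)
      ((Φ.symm ∘ path) (t - t))).hasMFDerivAt).comp t
      (HasMFDerivAt.comp (f := fun s : ℝ => s - t) t h2 h1)
    rw [e]
    convert h3 using 1
    ext
    let D : B →L[ℝ] B := mfderiv 𝓘(ℝ, B) 𝓘(ℝ, B) (fun x => c * x) ((Φ.symm ∘ path) (t - t))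
    exact (map_zero D).symm
  have hconst : ∀ t, path t = path 0 := fun t =>
    Φ.symm.injective (eq_of_hasMFDerivAt_eq_zero hγ t 0)
  have : HasDerivAt (fun t => ((path t : Bˣ) : B)) 0 0 := by
    simp only [hconst]
    exact hasDerivAt_const _ _
  exact hder.unique this

/-- The quotient map is `Φ.symm ∘ q`, so surjectivity of its differential forces that of `Φ.symm`.
With injectivity, the inverse function theorem applies to `Φ.symm`, and no complement to the kernel
of the differential of the quotient map is required. -/
theorem banachLieIsomorphic_of_isHomogeneousLieGroup
    [CompleteSpace B] (hW : IsOpenEmbedding fun w : W => ((w : Bˣ) : B))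
    (hσ : Continuous σ) (hτ : ∀ b, σ (τ b) = b) (hq : ∀ g, ((q g : Bˣ) : B) = σ g)
    (hqs : Function.Surjective q)
    (Φ : Aˣ ⧸ K ≃ₜ* W) (hΦ : ∀ g : Aˣ, Φ g = q g) (cs : ChartedSpace B (Aˣ ⧸ K))
    (h : IsHomogeneousLieGroup (E := A) K cs) :
    BanachLieIsomorphic cs hW.singletonChartedSpace := by
  let := hW.singletonChartedSpace
  have hsymm := contMDiff_quotient_equiv_symm hW hτ hq hqs Φ hΦ h
  refine ⟨Φ.toMulEquiv, fun x => ?_, hsymm⟩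
  obtain ⟨g, rfl⟩ := QuotientGroup.mk_surjective x
  have hx : Φ.symm (q g) = g := by rw [← hΦ]; exact Φ.symm_apply_apply _
  have hsurj : Function.Surjective (mfderiv 𝓘(ℝ, B) 𝓘(ℝ, B) Φ.symm (q g)) := by
    have e : (QuotientGroup.mk : Aˣ → Aˣ ⧸ K) = Φ.symm ∘ q := funext fun g => by
      rw [Function.comp_apply, ← hΦ]; exact (Φ.symm_apply_apply _).symm
    have h1 := h.surjective_mfderiv_mk g
    rw [e, mfderiv_comp g (hsymm.mdifferentiable (by simp) _)
      ((contMDiff_of_val_eq hW hσ hq).mdifferentiable (by simp) _)] at h1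
    exact Function.Surjective.of_comp h1
  have := Φ.symm.toHomeomorph.contMDiffAt_symm_of_bijective_mfderiv (n := ∞) (by simp)
    (hsymm (q g)) ⟨injective_mfderiv_quotient_equiv_symm hW hσ hτ hq hqs Φ hΦ h _, hsurj⟩
  change ContMDiffAt _ _ _ Φ (Φ.symm (q g)) at this
  rwa [hx] at this

end Quotient

end

theorem mainTheorem3 :
    (∃ cs : ChartedSpace C(Circle, ℂ) (toeplitzAlgebraˣ ⧸ onePlusCompact),
      IsHomogeneousLieGroup (E := toeplitzAlgebra) onePlusCompact cs) ∧
    (∀ cs : ChartedSpace C(Circle, ℂ) (toeplitzAlgebraˣ ⧸ onePlusCompact),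
      IsHomogeneousLieGroup (E := toeplitzAlgebra) onePlusCompact cs →
        BanachLieIsomorphic cs windingZeroChartedSpace) ∧
    (∀ x y : toeplitzAlgebraˣ ⧸ onePlusCompact, x * y = y * x) := by
  let σ : toeplitzAlgebra →ₐ[ℝ] C(Circle, ℂ) := symbol.restrictScalars ℝ
  let τ : C(Circle, ℂ) →L[ℝ] toeplitzAlgebra := toeplitzSection.restrictScalars ℝ
  have hσ : Continuous σ := continuous_symbol
  have hτ : ∀ φ, σ (τ φ) = φ := symbol_toeplitzSection
  have hq : ∀ g, ((unitsSymbol g : C(Circle, ℂ)ˣ) : C(Circle, ℂ)) = σ g := coe_unitsSymbol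
  obtain ⟨Φ, hΦ⟩ := exists_quotient_continuousMulEquiv isOpenEmbedding_windingZero hσ hτ hq
    unitsSymbol_surjective ker_unitsSymbol
  refine ⟨exists_isHomogeneousLieGroup isOpenEmbedding_windingZero hσ hτ hq Φ hΦ,
    banachLieIsomorphic_of_isHomogeneousLieGroup isOpenEmbedding_windingZero hσ hτ hq
      unitsSymbol_surjective Φ hΦ, fun x y => Φ.injective ?_⟩
  rw [map_mul, map_mul, mul_comm]
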